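/- Consider the unweighted $s$–$t$ shortest path problem: the input is a finite simple undirected graph $G=(V,E)$ (vertices labelled by natural numbers, given by its adjacency lists) together with two vertices $s,t\in V$ in the same connected component; the output is an $s$–$t$ walk. A randomized algorithm $\mathcal A$ computes from its input a positive integer $N$, draws $r\in\{0,\dots,N-1\}$ uniformly at random, and computes its output from the input and $r$, where both computations are given by computable functions. $\mathcal A(G)$ denotes the resulting distribution of the output. $\mathcal A$ is a $\rho$-approximation algorithm if on every such input, with probability $1$, it outputs an $s$–$t$ walk of length at most $\rho$ times the length of a shortest $s$–$t$ path. A walk $P=(e_1,\dots,e_\ell)$ is identified with the vector $\mathbf 1_P=\sum_{i=1}^{\ell}\mathbf 1_{e_i}$, so that edges are counted with multiplicity, and for two distributions $\mathcal F,\mathcal F'$ over walks let $$\mathrm{EM}_{\mathrm u}(\mathcal F,\mathcal F')=\inf_{\mathcal D}\ \mathbb E_{(P,P')\sim\mathcal D}\,\|\mathbf 1_P-\mathbf 1_{P'}\|_1 ,$$ where $\mathcal D$ ranges over the couplings of $\mathcal F$ and $\mathcal F'$. For an edge $e=\{u,v\}\in E$, the contraction $G/e$ has the vertex set $(V\setminus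 e)\cup\{v_e\}$ with a new vertex $v_e\notin V$ (with an arbitrary new label); its edges are the edges of $G$ that meet neither $u$ nor $v$, and $\{v_e,x\}$ for all $x\in (N(u)\cup N(v))\setminus\{u,v\}$. The contraction sensitivity of $\mathcal A$ on $G$ (with terminals $s,t$) is the supremum of $\mathrm{EM}_{\mathrm u}(\mathcal A(G),\mathcal A(G/e))$ over all edges $e\in E$ with $e\cap\{s,t\}=\emptyset$ and all labels of $v_e$. **Theorem.** There is an absolute constant $C>0$ such that for every $\varepsilon>0$ there is a randomized $(1+\varepsilon)$-approximation algorithm for the unweighted $s$–$t$ shortest path problem whose contraction sensitivity on every graph $G=(V,E)$, for all $s,t\in V$ in the same component of $G$, is at most $$C\cdot\max\{1,\varepsilon^{-1}\}\cdot\log^3|V| .$$ In particular, it is $O(\varepsilon^{-1}\log^3|V|)$ for $0<\varepsilon\le 1$. -/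

import Mathlib

open scoped ENNReal

/-- A finite simple undirected graph whose vertices are labelled by natural numbers. The vertex set
is `verts`; labels outside `verts` are isolated in `graph` and do not count as vertices. -/
structure FinGraph where
  verts : Finset ℕ
  graph : SimpleGraph ℕ
  mem_verts_of_adj : ∀ {u v : ℕ}, graph.Adj u v → u ∈ verts

namespace FinGraph

open Classical in
/-- The sorted adjacency-list encoding of a graph, the form in which algorithms receive it. -/
noncomputable def code (G : FinGraph) : List (ℕ × List ℕ) :=
  (G.verts.sort (· ≤ ·)).map fun v =>
    (v, (G.verts.filter fun x => G.graph.Adj v x).sort (· ≤ ·))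

/-- The edges of the graph obtained by contracting `{u, v}` to a vertex `w`: the edges that meet
neither `u` nor `v`, and `{w, x}` for `x ∈ (N(u) ∪ N(v)) \ {u, v}`. -/
def contractEdges (G : FinGraph) (u v w : ℕ) : Set (Sym2 ℕ) :=
  {e | e ∈ G.graph.edgeSet ∧ u ∉ e ∧ v ∉ e} ∪
    {e | ∃ x ∈ (G.graph.neighborSet u ∪ G.graph.neighborSet v) \ {u, v}, e = s(w, x)}

/-- `G.contract u v w` is the contraction `G / {u, v}`, in which the vertex that replaces `u` and
`v` has the label `w`. It is used for an edge `{u, v}` of `G` and a new label `w ∉ G.verts`. -/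
def contract (G : FinGraph) (u v w : ℕ) : FinGraph where
  verts := insert w (G.verts \ {u, v})
  graph := SimpleGraph.fromEdgeSet (G.contractEdges u v w)
  mem_verts_of_adj := by
    intro a b hab
    rw [SimpleGraph.fromEdgeSet_adj] at hab
    rcases hab.1 with ⟨he, hu, hv⟩ | ⟨x, ⟨hx, hxn⟩, he⟩
    · rw [Sym2.mem_iff, not_or] at hu hv
      have := G.mem_verts_of_adj ((SimpleGraph.mem_edgeSet _).1 he)
      simp only [Finset.mem_insert, Finset.mem_sdiff, Finset.mem_singleton, not_or]
      exact Or.inr ⟨this, Ne.symm hu.1, Ne.symm hv.1⟩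
    · have hxV : x ∈ G.verts := by
        rcases hx with h | h
        · exact G.mem_verts_of_adj (SimpleGraph.Adj.symm h)
        · exact G.mem_verts_of_adj (SimpleGraph.Adj.symm h)
      simp only [Set.mem_insert_iff, Set.mem_singleton_iff] at hxn
      simp only [Finset.mem_insert, Finset.mem_sdiff, Finset.mem_singleton]
      rcases Sym2.eq_iff.1 he with ⟨h1, -⟩ | ⟨h1, -⟩
      · exact Or.inl h1
      · exact Or.inr (h1 ▸ ⟨hxV, hxn⟩)

end FinGraph

/-- The multiset of edges traversed by the walk with the given sequence of vertices. -/
def walkEdges (l : List ℕ) : Multiset (Sym2 ℕ) :=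
  (List.zipWith (fun x y => s(x, y)) l l.tail : List (Sym2 ℕ))

/-- The `ℓ¹`-distance `‖∑_{e ∈ P} 1_e - ∑_{e ∈ Q} 1_e‖₁` between two walks `P`, `Q`, edges being
counted with multiplicity. -/
def walkDist (P Q : List ℕ) : ℕ :=
  ∑ e ∈ (walkEdges P).toFinset ∪ (walkEdges Q).toFinset,
    (((walkEdges P).count e : ℤ) - ((walkEdges Q).count e : ℤ)).natAbs

/-- `D` is a coupling of `p` and `q`. -/
def IsCoupling {β : Type} (D : PMF (β × β)) (p q : PMF β) : Prop :=
  D.map Prod.fst = p ∧ D.map Prod.snd = q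

/-- The earth mover's distance between two distributions over walks, with respect to `walkDist`. -/
noncomputable def earthMover (p q : PMF (List ℕ)) : ℝ≥0∞ :=
  ⨅ (D : PMF (List ℕ × List ℕ)) (_ : IsCoupling D p q),
    ∑' z : List ℕ × List ℕ, D z * (walkDist z.1 z.2 : ℝ≥0∞)

/-- A randomized algorithm: on an input `x` it computes a positive number `numSeeds x`, draws an
integer `r` uniformly from `{0, …, numSeeds x - 1}`, and computes `run x r`. (Any finite number
of uniform draws from finite ranges can be read off from one such draw.) -/
structure RandomizedAlgorithm (α β : Type) [Primcodable α] [Primcodable β] where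
  numSeeds : α → ℕ
  run : α → ℕ → β
  numSeeds_pos : ∀ x, 0 < numSeeds x
  computable_numSeeds : Computable numSeeds
  computable_run : Computable₂ run

/-- The distribution of the output of a randomized algorithm. -/
noncomputable def RandomizedAlgorithm.output {α β : Type} [Primcodable α] [Primcodable β]
    (A : RandomizedAlgorithm α β) (x : α) : PMF β :=
  (PMF.uniformOfFinset (Finset.range (A.numSeeds x))
    ⟨0, Finset.mem_range.2 (A.numSeeds_pos x)⟩).map (A.run x)

/-- A randomized algorithm whose inputs are an adjacency list and two vertices, and whose outputs
are sequences of vertices. -/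
abbrev PathAlgorithm : Type :=
  RandomizedAlgorithm (List (ℕ × List ℕ) × ℕ × ℕ) (List ℕ)

namespace PathAlgorithm

/-- The output distribution of `A` on the graph `G` with source `s` and target `t`. -/
noncomputable def outputOn (A : PathAlgorithm) (G : FinGraph) (s t : ℕ) : PMF (List ℕ) :=
  RandomizedAlgorithm.output A (G.code, s, t)

/-- `A` is a `ρ`-approximation algorithm for the unweighted shortest path problem: whenever `s`
and `t` are connected in `G`, every possible output is (the vertex sequence of) an `s`-`t` walk
whose length is at most `ρ` times the length of a shortest `s`-`t` path. -/
def IsApproximation (A : PathAlgorithm) (ρ : ℝ) : Prop :=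
  ∀ (G : FinGraph) (s t : ℕ), s ∈ G.verts → t ∈ G.verts → G.graph.Reachable s t →
    ∀ l ∈ (outputOn A G s t).support,
      ∃ p : G.graph.Walk s t, p.support = l ∧ (p.length : ℝ) ≤ ρ * (G.graph.dist s t : ℝ)

/-- The contraction sensitivity of `A` on `G` with source `s` and target `t`: the supremum of the
earth mover's distance between the outputs on `G` and on `G / {u, v}`, over all edges `{u, v}`
of `G` with `{u, v} ∩ {s, t} = ∅` (and all labels `w` for the new vertex). -/
noncomputable def contractionSensitivity (A : PathAlgorithm) (G : FinGraph) (s t : ℕ) : ℝ≥0∞ :=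
  ⨆ (u : ℕ) (v : ℕ) (w : ℕ) (_ : G.graph.Adj u v)
    (_ : Disjoint ({u, v} : Set ℕ) {s, t}) (_ : w ∉ G.verts),
    earthMover (outputOn A G s t) (outputOn A (G.contract u v w) s t)

end PathAlgorithm

/-! ### Optimal transport between discrete distributions -/

/-! The walk comes from recursive random splitting. On level `j + 1`, with `T = gap j / 4` and `U =
K * T`, a position `R` is uniform in `[2U, 3U)` and a slack `τ` is uniform in `[T + 1, 2T]`. A
segment from `x` to `y` of length `d ≤ R` passes unsplit. Otherwise it is split at a vertex `z`,
uniform among those with `d(x,z) ≤ R + τ` and `d(z,y) ≤ d - R + τ`. Segments left at level `0`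
become canonical shortest paths. A split costs at most `2τ ≤ 4T ≤ (2/K) d` extra length, so `J`
levels stretch by at most `(1 + 2/K)^J`, which is at most `1 + 1/k` for `K = 70 k J`
(`isWalkOfLength_walkPMF`).

Contracting `uv` to `w` affects one level in three ways. (1) Distances drop by at most one, so the
new candidate set lies between the old ones of slack `τ - 1` and `τ + 1`, up to `u`, `v`, `w`. The
loss of overlap is bounded by a difference of logarithms of cardinalities
(`one_sub_card_inter_div_le`), which telescopes over `τ` and averages to `O(log n / T)`. A failed
coupling costs one whole segment, `O(K T)`, so the expected cost is `O(K log n)`. (2) The test `d ≤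
R` changes for at most one of the `U` values of `R`, at cost `O(U)`. (3) If `z` is common, a part
whose detours through `uv` are long enough has exactly the same distribution in both graphs
(`Far.walkPMF_eq`). Both parts can be affected only if `R` is within `O(T)` of the distance from `x`
to the edge, which has probability at most `70 / K`.

Hence the expected cost obeys `H (j+1) ≤ (1 + 70/K) H j + β` with `β = O(K log n)`, and `H J = O(K J
log n) = O(k log³ n)` (`transport_walkPMF`).

Since `K` and `J` depend on the size, which the contraction changes, they are computed from a random
`M` in `[n, 2n)`. The two ranges of `M` miss each other with probability at most `2/n`, and a walk
has length `O(n)` (`transport_output`). To realise the process computably, all random choices are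
read as mixed-radix digits of a single seed (`map_expand_code`, `outputOn_walkAlgorithm`). -/

theorem PMF.tsum_bind_mul {α β : Type*} (p : PMF α) (f : α → PMF β) (φ : β → ℝ≥0∞) :
    ∑' b, (p.bind f) b * φ b = ∑' a, p a * ∑' b, f a b * φ b := by
  simp only [PMF.bind_apply, ← ENNReal.tsum_mul_right, ← ENNReal.tsum_mul_left]
  rw [ENNReal.tsum_comm]
  simp only [mul_assoc]

theorem PMF.tsum_pure_mul {α : Type*} (a : α) (φ : α → ℝ≥0∞) :
    ∑' b, (PMF.pure a) b * φ b = φ a := by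
  rw [tsum_eq_single a]
  · simp
  · intro b hb
    simp [PMF.pure_apply, hb]

theorem PMF.tsum_map_mul {α β : Type*} (p : PMF α) (f : α → β) (φ : β → ℝ≥0∞) :
    ∑' b, (p.map f) b * φ b = ∑' a, p a * φ (f a) := by
  rw [← PMF.bind_pure_comp, PMF.tsum_bind_mul]
  simp only [Function.comp_apply, PMF.tsum_pure_mul]

theorem PMF.bind_congr_support {α β : Type*} (p : PMF α) {f g : α → PMF β}
    (h : ∀ a ∈ p.support, f a = g a) : p.bind f = p.bind g := by
  ext b
  simp only [PMF.bind_apply]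
  refine tsum_congr fun a => ?_
  by_cases ha : p a = 0
  · simp [ha]
  · rw [h a ((PMF.mem_support_iff p a).2 ha)]

/-- Some coupling of `p` and `q` has expected cost at most `c`. -/
def TransportLE {α β : Type*} (κ : α → β → ℝ≥0∞) (p : PMF α) (q : PMF β) (c : ℝ≥0∞) : Prop :=
  ∃ D : PMF (α × β), D.map Prod.fst = p ∧ D.map Prod.snd = q ∧ ∑' z, D z * κ z.1 z.2 ≤ c

namespace TransportLE

variable {α β γ δ : Type*}

theorem mono {κ : α → β → ℝ≥0∞} {p : PMF α} {q : PMF β} {c c' : ℝ≥0∞}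
    (h : TransportLE κ p q c) (hc : c ≤ c') : TransportLE κ p q c' := by
  obtain ⟨D, h1, h2, h3⟩ := h
  exact ⟨D, h1, h2, h3.trans hc⟩

theorem refl {κ : α → α → ℝ≥0∞} (hκ : ∀ a, κ a a = 0) (p : PMF α) : TransportLE κ p p 0 := by
  refine ⟨p.map fun a => (a, a), ?_, ?_, ?_⟩
  · rw [PMF.map_comp]; exact PMF.map_id p
  · rw [PMF.map_comp]; exact PMF.map_id p
  · rw [PMF.tsum_map_mul p (fun a => (a, a)) (fun z => κ z.1 z.2)]
    simp [hκ]

/-- Conditionally on a coupling of `p` and `q`, couplings can be chosen freely. -/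
theorem bind_of_coupling {κ : γ → δ → ℝ≥0∞} {f : α → PMF γ} {g : β → PMF δ}
    (D : PMF (α × β)) (c : α → β → ℝ≥0∞)
    (h : ∀ z ∈ D.support, TransportLE κ (f z.1) (g z.2) (c z.1 z.2)) :
    TransportLE κ ((D.map Prod.fst).bind f) ((D.map Prod.snd).bind g)
      (∑' z, D z * c z.1 z.2) := by
  have : Nonempty (PMF (γ × δ)) := by
    obtain ⟨z, hz⟩ := D.support_nonempty
    exact ⟨(h z hz).choose⟩
  choose! E h1 h2 h3 using h
  refine ⟨D.bind E, ?_, ?_, ?_⟩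
  · rw [PMF.map_bind, PMF.bind_map]
    exact PMF.bind_congr_support _ fun z hz => h1 z hz
  · rw [PMF.map_bind, PMF.bind_map]
    exact PMF.bind_congr_support _ fun z hz => h2 z hz
  · rw [PMF.tsum_bind_mul]
    refine ENNReal.tsum_le_tsum fun z => ?_
    by_cases hz : D z = 0
    · simp [hz]
    · gcongr
      exact h3 z ((PMF.mem_support_iff D z).2 hz)

theorem bind_same {κ : γ → δ → ℝ≥0∞} {f : α → PMF γ} {g : α → PMF δ}
    (p : PMF α) (c : α → ℝ≥0∞) (h : ∀ a ∈ p.support, TransportLE κ (f a) (g a) (c a)) :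
    TransportLE κ (p.bind f) (p.bind g) (∑' a, p a * c a) := by
  have := bind_of_coupling (κ := κ) (f := f) (g := g) (p.map fun a => (a, a)) (fun a _ => c a) (by
    intro z hz
    rw [PMF.support_map] at hz
    obtain ⟨a, ha, rfl⟩ := hz
    exact h a ha)
  rw [PMF.map_comp, PMF.map_comp,
    PMF.tsum_map_mul p (fun a => (a, a)) (fun z => c z.1)] at this
  have e : p.map (Prod.fst ∘ fun a => (a, a)) = p := PMF.map_id p
  have e' : p.map (Prod.snd ∘ fun a => (a, a)) = p := PMF.map_id p
  rwa [e, e'] at this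

/-- The independent coupling. -/
theorem of_forall_le {κ : α → β → ℝ≥0∞} {p : PMF α} {q : PMF β} {B : ℝ≥0∞}
    (h : ∀ a ∈ p.support, ∀ b ∈ q.support, κ a b ≤ B) : TransportLE κ p q B := by
  refine ⟨p.bind fun a => q.map fun b => (a, b), ?_, ?_, ?_⟩
  · rw [PMF.map_bind]
    have : (fun a : α => (q.map fun b => (a, b)).map Prod.fst) = PMF.pure := by
      funext a
      rw [PMF.map_comp]
      exact PMF.map_const q a
    rw [this, PMF.bind_pure]
  · rw [PMF.map_bind]
    have : (fun a : α => (q.map fun b => (a, b)).map Prod.snd) = fun _ => q := by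
      funext a
      rw [PMF.map_comp]
      exact PMF.map_id q
    rw [this, PMF.bind_const]
  · rw [PMF.tsum_bind_mul]
    calc ∑' a, p a * ∑' z, (q.map fun b => (a, b)) z * κ z.1 z.2
        ≤ ∑' a, p a * B := by
          refine ENNReal.tsum_le_tsum fun a => ?_
          by_cases ha : p a = 0
          · simp [ha]
          gcongr
          rw [PMF.tsum_map_mul q (fun b => (a, b)) (fun z => κ z.1 z.2)]
          calc ∑' b, q b * κ a b ≤ ∑' b, q b * B := by
                refine ENNReal.tsum_le_tsum fun b => ?_
                by_cases hb : q b = 0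
                · simp [hb]
                gcongr
                exact h a ((PMF.mem_support_iff p a).2 ha) b ((PMF.mem_support_iff q b).2 hb)
            _ = B := by rw [ENNReal.tsum_mul_right, PMF.tsum_coe, one_mul]
      _ = B := by rw [ENNReal.tsum_mul_right, PMF.tsum_coe, one_mul]

theorem mono_cost {κ κ' : α → β → ℝ≥0∞} {p : PMF α} {q : PMF β} {c : ℝ≥0∞}
    (h : TransportLE κ p q c) (hκ : ∀ a ∈ p.support, ∀ b ∈ q.support, κ' a b ≤ κ a b) :
    TransportLE κ' p q c := by
  obtain ⟨D, rfl, rfl, h3⟩ := h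
  refine ⟨D, rfl, rfl, le_trans (ENNReal.tsum_le_tsum fun z => ?_) h3⟩
  by_cases hz : D z = 0
  · simp [hz]
  have hz' := (PMF.mem_support_iff D z).2 hz
  gcongr
  refine hκ _ ?_ _ ?_
  · rw [PMF.support_map]; exact ⟨z, hz', rfl⟩
  · rw [PMF.support_map]; exact ⟨z, hz', rfl⟩

theorem of_map {κ : γ → δ → ℝ≥0∞} {p : PMF α} {q : PMF β} {c : ℝ≥0∞} (f : α → γ) (g : β → δ)
    (h : TransportLE (fun a b => κ (f a) (g b)) p q c) : TransportLE κ (p.map f) (q.map g) c := by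
  obtain ⟨D, rfl, rfl, h3⟩ := h
  refine ⟨D.map fun z => (f z.1, g z.2), ?_, ?_, ?_⟩
  · rw [PMF.map_comp, PMF.map_comp]; rfl
  · rw [PMF.map_comp, PMF.map_comp]; rfl
  · rwa [PMF.tsum_map_mul D (fun z => (f z.1, g z.2)) (fun z => κ z.1 z.2)]

theorem add_const {κ : α → β → ℝ≥0∞} {p : PMF α} {q : PMF β} {c : ℝ≥0∞} (b : ℝ≥0∞)
    (h : TransportLE κ p q c) : TransportLE (fun x y => b + κ x y) p q (b + c) := by
  obtain ⟨D, rfl, rfl, h3⟩ := h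
  refine ⟨D, rfl, rfl, ?_⟩
  simp only [mul_add]
  rw [ENNReal.tsum_add, ENNReal.tsum_mul_right, PMF.tsum_coe, one_mul]
  gcongr

/-- Costs add up when two independent samples are combined. -/
theorem combine {α' β' : Type*} {κ₁ : α → α' → ℝ≥0∞} {κ₂ : β → β' → ℝ≥0∞} {κ : γ → δ → ℝ≥0∞}
    {p : PMF α} {p' : PMF α'} {q : PMF β} {q' : PMF β'} {c₁ c₂ : ℝ≥0∞}
    (hp : TransportLE κ₁ p p' c₁) (hq : TransportLE κ₂ q q' c₂)
    (f : α → β → γ) (g : α' → β' → δ)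
    (h : ∀ a ∈ p.support, ∀ a' ∈ p'.support, ∀ b ∈ q.support, ∀ b' ∈ q'.support,
      κ (f a b) (g a' b') ≤ κ₁ a a' + κ₂ b b') :
    TransportLE κ (p.bind fun a => q.map (f a)) (p'.bind fun a' => q'.map (g a')) (c₁ + c₂) := by
  obtain ⟨D, rfl, rfl, h3⟩ := hp
  refine (bind_of_coupling D (fun a a' => κ₁ a a' + c₂) ?_).mono ?_
  · intro z hz
    refine of_map _ _ ((hq.add_const (κ₁ z.1 z.2)).mono_cost fun b hb b' hb' => ?_)
    refine h _ ?_ _ ?_ b hb b' hb'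
    · rw [PMF.support_map]; exact ⟨z, hz, rfl⟩
    · rw [PMF.support_map]; exact ⟨z, hz, rfl⟩
  · simp only [mul_add]
    rw [ENNReal.tsum_add, ENNReal.tsum_mul_right, PMF.tsum_coe, one_mul]
    gcongr

/-- Sampling from `p` and from `q` can be coupled so that both samples agree on a common part `m`
of the two distributions. -/
theorem bind_of_common {κ : γ → δ → ℝ≥0∞} {f : α → PMF γ} {g : α → PMF δ} {p q : PMF α}
    {m : α → ℝ≥0∞} (hmp : ∀ a, m a ≤ p a) (hmq : ∀ a, m a ≤ q a) {c B : ℝ≥0∞}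
    (hc : ∀ a, m a ≠ 0 → TransportLE κ (f a) (g a) c)
    (hB : ∀ a ∈ p.support, ∀ b ∈ q.support, TransportLE κ (f a) (g b) B) :
    TransportLE κ (p.bind f) (q.bind g) (c + (1 - ∑' a, m a) * B) := by
  classical
  set s := ∑' a, m a with hs
  have hs1 : s ≤ 1 := by
    rw [← PMF.tsum_coe p]; exact ENNReal.tsum_le_tsum hmp
  have hst : s ≠ ⊤ := ne_top_of_le_ne_top ENNReal.one_ne_top hs1
  set η := 1 - s with hη
  have hηt : η ≠ ⊤ := ne_top_of_le_ne_top ENNReal.one_ne_top tsub_le_self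
  have hsub : ∀ r : PMF α, (∀ a, m a ≤ r a) → ∑' a, (r a - m a) = η := by
    intro r hr
    refine ENNReal.eq_sub_of_add_eq hst ?_
    rw [hs, ← ENNReal.tsum_add, ← PMF.tsum_coe r]
    exact tsum_congr fun a => tsub_add_cancel_of_le (hr a)
  -- This also holds for `η = 0`, where `η⁻¹ = ⊤`, because then `x = 0`. Total overlap thus needs no
  -- separate coupling.
  have hmul : ∀ x : ℝ≥0∞, x ≤ η → x * η⁻¹ * η = x := by
    intro x hx
    by_cases h0 : η = 0
    · rw [h0] at hx
      simp [nonpos_iff_eq_zero.1 hx]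
    · rw [mul_assoc, ENNReal.inv_mul_cancel h0 hηt, mul_one]
  have hple : ∀ r : PMF α, (∀ a, m a ≤ r a) → ∀ a, r a - m a ≤ η := by
    intro r hr a
    rw [← hsub r hr]; exact ENNReal.le_tsum a
  -- The common part sits on the diagonal; the two remainders, both of mass `η`, are coupled
  -- independently.
  let d : α × α → ℝ≥0∞ := fun z =>
    (if z.1 = z.2 then m z.1 else 0) + (p z.1 - m z.1) * η⁻¹ * (q z.2 - m z.2)
  have hrow : ∀ a, ∑' b, d (a, b) = p a := by
    intro a
    simp only [d]
    rw [ENNReal.tsum_add, ENNReal.tsum_mul_left, hsub q hmq, hmul _ (hple p hmp a)]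
    rw [tsum_eq_single a (fun b hb => if_neg (Ne.symm hb)), if_pos rfl]
    exact add_tsub_cancel_of_le (hmp a)
  have hcol : ∀ b, ∑' a, d (a, b) = q b := by
    intro b
    simp only [d]
    rw [ENNReal.tsum_add, ENNReal.tsum_mul_right, ENNReal.tsum_mul_right, hsub p hmp]
    rw [tsum_eq_single b (fun a ha => if_neg ha), if_pos rfl, mul_comm, mul_comm η, ← mul_assoc,
      hmul _ (hple q hmq b)]
    exact add_tsub_cancel_of_le (hmq b)
  have htot : ∑' z, d z = 1 := by
    rw [ENNReal.tsum_prod']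
    simp only [hrow, PMF.tsum_coe]
  let D : PMF (α × α) := ⟨d, htot ▸ ENNReal.summable.hasSum⟩
  have hD1 : D.map Prod.fst = p := by
    ext a
    rw [PMF.map_apply, ENNReal.tsum_prod', tsum_eq_single a]
    · simp only [if_true]; exact hrow a
    · intro a' ha'
      simp [Ne.symm ha']
  have hD2 : D.map Prod.snd = q := by
    ext b
    rw [PMF.map_apply, ENNReal.tsum_prod', ENNReal.tsum_comm, tsum_eq_single b]
    · simp only [if_true]; exact hcol b
    · intro b' hb'
      simp [Ne.symm hb']
  have hDp : ∀ z ∈ D.support, z.1 ∈ p.support ∧ z.2 ∈ q.support := by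
    intro z hz
    constructor
    · rw [← hD1, PMF.support_map]; exact ⟨z, hz, rfl⟩
    · rw [← hD2, PMF.support_map]; exact ⟨z, hz, rfl⟩
  -- A diagonal point may carry common and residual mass at once, but only one coupling is chosen
  -- there. The minimum of `c` and `B` serves both terms of the estimate.
  have key := bind_of_coupling (κ := κ) (f := f) (g := g) D
    (fun a b => if a = b ∧ m a ≠ 0 then min c B else B) (by
      intro z hz
      obtain ⟨h1, h2⟩ := hDp z hz
      split_ifs with h
      · rcases min_choice c B with h' | h' <;> rw [h']
        · rw [← h.1]; exact hc _ h.2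
        · exact hB _ h1 _ h2
      · exact hB _ h1 _ h2)
  rw [hD1, hD2] at key
  refine key.mono ?_
  calc ∑' z, D z * (if z.1 = z.2 ∧ m z.1 ≠ 0 then min c B else B)
      ≤ ∑' z : α × α, ((if z.1 = z.2 then m z.1 else 0) * c
          + (p z.1 - m z.1) * η⁻¹ * (q z.2 - m z.2) * B) := by
        refine ENNReal.tsum_le_tsum fun z => ?_
        change d z * _ ≤ _
        simp only [d, add_mul]
        refine add_le_add ?_ ?_
        · by_cases h1 : z.1 = z.2
          · by_cases h2 : m z.1 = 0
            · rw [if_pos h1, h2, zero_mul]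
              exact zero_le
            · rw [if_pos h1, if_pos ⟨h1, h2⟩]
              gcongr
              exact min_le_left _ _
          · simp [h1]
        · gcongr
          split_ifs
          · exact min_le_right _ _
          · exact le_rfl
    _ = s * c + η * B := by
        rw [ENNReal.tsum_add, ENNReal.tsum_mul_right, ENNReal.tsum_mul_right, ENNReal.tsum_prod',
          ENNReal.tsum_prod']
        congr 2
        · refine tsum_congr fun a => ?_
          rw [tsum_eq_single a (fun b hb => if_neg (Ne.symm hb)), if_pos rfl]
        · simp only [ENNReal.tsum_mul_left, hsub q hmq]
          rw [← hsub p hmp]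
          refine tsum_congr fun a => ?_
          rw [hsub p hmp]
          exact hmul _ (hple p hmp a)
    _ ≤ c + η * B := by
        gcongr
        calc s * c ≤ 1 * c := by gcongr
          _ = c := one_mul c

end TransportLE

/-! ### The distance between walks -/

/-- The `ℓ¹`-distance of two multisets. -/
def multisetDist {α : Type*} [DecidableEq α] (A B : Multiset α) : ℕ :=
  (A - B).card + (B - A).card

/-- The two truncated differences count the positive and the negative part of the difference of
multiplicities. -/
theorem multisetDist_eq_sum {α : Type*} [DecidableEq α] (A B : Multiset α) :
    multisetDist A B =
      ∑ e ∈ A.toFinset ∪ B.toFinset, ((A.count e : ℤ) - (B.count e : ℤ)).natAbs := by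
  have h1 : (A - B).card = ∑ e ∈ A.toFinset ∪ B.toFinset, (A - B).count e := by
    rw [Multiset.sum_count_eq_card]
    intro a ha
    rw [Finset.mem_union, Multiset.mem_toFinset]
    exact Or.inl (Multiset.mem_of_le (Multiset.sub_le_self A B) ha)
  have h2 : (B - A).card = ∑ e ∈ A.toFinset ∪ B.toFinset, (B - A).count e := by
    rw [Multiset.sum_count_eq_card]
    intro a ha
    rw [Finset.mem_union, Multiset.mem_toFinset, Multiset.mem_toFinset]
    exact Or.inr (Multiset.mem_of_le (Multiset.sub_le_self B A) ha)
  rw [multisetDist, h1, h2, ← Finset.sum_add_distrib]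
  refine Finset.sum_congr rfl fun e _ => ?_
  rw [Multiset.count_sub, Multiset.count_sub]
  omega

theorem multisetDist_self {α : Type*} [DecidableEq α] (A : Multiset α) : multisetDist A A = 0 := by
  simp [multisetDist]

theorem multisetDist_le_card_add_card {α : Type*} [DecidableEq α] (A B : Multiset α) :
    multisetDist A B ≤ A.card + B.card :=
  add_le_add (Multiset.card_le_card (Multiset.sub_le_self A B))
    (Multiset.card_le_card (Multiset.sub_le_self B A))

theorem multisetDist_add_le {α : Type*} [DecidableEq α] (A B A' B' : Multiset α) :
    multisetDist (A + B) (A' + B') ≤ multisetDist A A' + multisetDist B B' := by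
  have h : ∀ A B A' B' : Multiset α,
      ((A + B) - (A' + B')).card ≤ (A - A').card + (B - B').card := by
    intro A B A' B'
    rw [← Multiset.card_add]
    refine Multiset.card_le_card (Multiset.le_iff_count.2 fun e => ?_)
    simp only [Multiset.count_sub, Multiset.count_add]
    omega
  have h1 := h A B A' B'
  have h2 := h A' B' A B
  unfold multisetDist
  omega

theorem walkDist_eq (P Q : List ℕ) :
    walkDist P Q = multisetDist (walkEdges P) (walkEdges Q) :=
  (multisetDist_eq_sum _ _).symm

theorem walkEdges_cons_cons (x y : ℕ) (l : List ℕ) :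
    walkEdges (x :: y :: l) = s(x, y) ::ₘ walkEdges (y :: l) := rfl

theorem SimpleGraph.Walk.walkEdges_support {G : SimpleGraph ℕ} {x y : ℕ} (p : G.Walk x y) :
    walkEdges p.support = (p.edges : Multiset (Sym2 ℕ)) := by
  induction p with
  | nil => rfl
  | cons h p ih =>
    rw [SimpleGraph.Walk.support_cons, SimpleGraph.Walk.edges_cons, ← Multiset.cons_coe, ← ih]
    rw [← p.cons_tail_support, walkEdges_cons_cons]

/-- `l` is the vertex sequence of a walk from `x` to `y` of length at most `c`. -/
def IsWalkOfLength (G : SimpleGraph ℕ) (x y : ℕ) (c : ℝ) (l : List ℕ) : Prop :=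
  ∃ p : G.Walk x y, p.support = l ∧ (p.length : ℝ) ≤ c

theorem IsWalkOfLength.append {G : SimpleGraph ℕ} {x y z : ℕ} {c c' : ℝ} {l l' : List ℕ}
    (h : IsWalkOfLength G x y c l) (h' : IsWalkOfLength G y z c' l') :
    IsWalkOfLength G x z (c + c') (l ++ l'.tail) := by
  obtain ⟨p, rfl, hp⟩ := h
  obtain ⟨q, rfl, hq⟩ := h'
  refine ⟨p.append q, SimpleGraph.Walk.support_append p q, ?_⟩
  rw [SimpleGraph.Walk.length_append]
  push_cast
  linarith

theorem IsWalkOfLength.mono {G : SimpleGraph ℕ} {x y : ℕ} {c c' : ℝ} {l : List ℕ}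
    (h : IsWalkOfLength G x y c l) (hc : c ≤ c') : IsWalkOfLength G x y c' l := by
  obtain ⟨p, rfl, hp⟩ := h
  exact ⟨p, rfl, hp.trans hc⟩

theorem IsWalkOfLength.walkEdges_append {G : SimpleGraph ℕ} {x y z : ℕ} {c c' : ℝ}
    {l l' : List ℕ} (h : IsWalkOfLength G x y c l) (h' : IsWalkOfLength G y z c' l') :
    walkEdges (l ++ l'.tail) = walkEdges l + walkEdges l' := by
  obtain ⟨p, rfl, hp⟩ := h
  obtain ⟨q, rfl, hq⟩ := h'
  rw [← SimpleGraph.Walk.support_append, SimpleGraph.Walk.walkEdges_support,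
    SimpleGraph.Walk.walkEdges_support, SimpleGraph.Walk.walkEdges_support,
    SimpleGraph.Walk.edges_append, Multiset.coe_add]

theorem IsWalkOfLength.card_walkEdges_le {G : SimpleGraph ℕ} {x y : ℕ} {c : ℝ}
    {l : List ℕ} (h : IsWalkOfLength G x y c l) : ((walkEdges l).card : ℝ) ≤ c := by
  obtain ⟨p, rfl, hp⟩ := h
  rw [SimpleGraph.Walk.walkEdges_support, Multiset.coe_card, SimpleGraph.Walk.length_edges]
  exact hp

theorem walkDist_append_le {G G' : SimpleGraph ℕ} {x y z x' y' z' : ℕ} {c₁ c₂ c₃ c₄ : ℝ}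
    {l₁ l₂ l₃ l₄ : List ℕ} (h₁ : IsWalkOfLength G x y c₁ l₁) (h₂ : IsWalkOfLength G y z c₂ l₂)
    (h₃ : IsWalkOfLength G' x' y' c₃ l₃) (h₄ : IsWalkOfLength G' y' z' c₄ l₄) :
    walkDist (l₁ ++ l₂.tail) (l₃ ++ l₄.tail) ≤ walkDist l₁ l₃ + walkDist l₂ l₄ := by
  simp only [walkDist_eq]
  rw [h₁.walkEdges_append h₂, h₃.walkEdges_append h₄]
  exact multisetDist_add_le _ _ _ _

theorem walkDist_self (l : List ℕ) : walkDist l l = 0 := by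
  rw [walkDist_eq, multisetDist_self]

theorem walkDist_le_add {G G' : SimpleGraph ℕ} {x y x' y' : ℕ} {c c' : ℝ} {l l' : List ℕ}
    (h : IsWalkOfLength G x y c l) (h' : IsWalkOfLength G' x' y' c' l') :
    (walkDist l l' : ℝ≥0∞) ≤ ENNReal.ofReal (c + c') := by
  have h1 : (walkDist l l' : ℝ) ≤ c + c' := by
    have := multisetDist_le_card_add_card (walkEdges l) (walkEdges l')
    rw [← walkDist_eq] at this
    have h2 : (walkDist l l' : ℝ) ≤ ((walkEdges l).card : ℝ) + ((walkEdges l').card : ℝ) := by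
      exact_mod_cast this
    linarith [h.card_walkEdges_le, h'.card_walkEdges_le]
  rw [← ENNReal.ofReal_natCast]
  exact ENNReal.ofReal_le_ofReal h1

/-! ### Distances in a contracted graph -/

namespace FinGraph

variable {G : FinGraph} {u v w : ℕ}

theorem not_adj_of_notMem (hw : w ∉ G.verts) (x : ℕ) : ¬ G.graph.Adj w x :=
  fun h => hw (G.mem_verts_of_adj h)

theorem mem_verts_of_reachable {x y : ℕ} (hx : x ∈ G.verts) (h : G.graph.Reachable x y) :
    y ∈ G.verts := by
  obtain ⟨p⟩ := h
  induction p with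
  | nil => exact hx
  | cons h p ih => exact ih (G.mem_verts_of_adj h.symm)

theorem contract_adj_of_adj {a b : ℕ} (h : G.graph.Adj a b) (ha : a ≠ u ∧ a ≠ v)
    (hb : b ≠ u ∧ b ≠ v) : (G.contract u v w).graph.Adj a b := by
  refine (SimpleGraph.fromEdgeSet_adj _).2 ⟨Or.inl ⟨h, ?_, ?_⟩, h.ne⟩
  · rw [Sym2.mem_iff, not_or]; exact ⟨ha.1.symm, hb.1.symm⟩
  · rw [Sym2.mem_iff, not_or]; exact ⟨ha.2.symm, hb.2.symm⟩

theorem contract_adj_new {a : ℕ} (hw : w ∉ G.verts) (h : G.graph.Adj a u ∨ G.graph.Adj a v)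
    (ha : a ≠ u ∧ a ≠ v) : (G.contract u v w).graph.Adj a w := by
  have haV : a ∈ G.verts := by
    rcases h with h | h <;> exact G.mem_verts_of_adj h
  refine (SimpleGraph.fromEdgeSet_adj _).2 ⟨Or.inr ⟨a, ⟨?_, ?_⟩, Sym2.eq_swap⟩, ?_⟩
  · exact h.imp (fun h => h.symm) (fun h => h.symm)
  · simp [ha.1, ha.2]
  · rintro rfl; exact hw haV

theorem adj_of_contract_adj {a b : ℕ} (h : (G.contract u v w).graph.Adj a b) (ha : a ≠ w)
    (hb : b ≠ w) : G.graph.Adj a b := by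
  rcases ((SimpleGraph.fromEdgeSet_adj _).1 h).1 with ⟨h, -, -⟩ | ⟨x, -, hx⟩
  · exact h
  · rcases Sym2.eq_iff.1 hx with ⟨h, -⟩ | ⟨-, h⟩
    · exact absurd h ha
    · exact absurd h hb

theorem adj_of_contract_adj_new {a : ℕ} (hw : w ∉ G.verts)
    (h : (G.contract u v w).graph.Adj a w) : G.graph.Adj a u ∨ G.graph.Adj a v := by
  obtain ⟨h1, hne⟩ := (SimpleGraph.fromEdgeSet_adj _).1 h
  rcases h1 with ⟨h, -, -⟩ | ⟨x, hx, hx'⟩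
  · exact absurd h.symm (not_adj_of_notMem hw a)
  · rcases Sym2.eq_iff.1 hx' with ⟨h, -⟩ | ⟨h, -⟩
    · exact absurd h hne
    · subst h
      exact hx.1.imp (fun h => h.symm) (fun h => h.symm)

/-- There is a walk of length at most `n` from `x` to one of `u`, `v`. -/
def NearEdge (G : FinGraph) (u v x n : ℕ) : Prop :=
  (∃ p : G.graph.Walk x u, p.length ≤ n) ∨ ∃ p : G.graph.Walk x v, p.length ≤ n

theorem NearEdge.cons {x y n : ℕ} (hxy : G.graph.Adj x y) (h : G.NearEdge u v y n) :
    G.NearEdge u v x (n + 1) := by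
  rcases h with ⟨p, hp⟩ | ⟨p, hp⟩
  · exact Or.inl ⟨.cons hxy p, by simpa using hp⟩
  · exact Or.inr ⟨.cons hxy p, by simpa using hp⟩

theorem nearEdge_one {x : ℕ} (h : G.graph.Adj x u ∨ G.graph.Adj x v) : G.NearEdge u v x 1 := by
  rcases h with h | h
  · exact Or.inl ⟨h.toWalk, by simp⟩
  · exact Or.inr ⟨h.toWalk, by simp⟩

theorem nearEdge_of_contract_walk (hw : w ∉ G.verts) {a b : ℕ}
    (q : (G.contract u v w).graph.Walk a b) (hb : b = w) (ha : a ≠ w) :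
    G.NearEdge u v a q.length := by
  induction q with
  | nil => exact absurd hb ha
  | @cons a c b h q ih =>
    by_cases hc : c = w
    · subst hc
      have := nearEdge_one (adj_of_contract_adj_new hw h)
      rcases this with ⟨p, hp⟩ | ⟨p, hp⟩
      · exact Or.inl ⟨p, hp.trans (by simp)⟩
      · exact Or.inr ⟨p, hp.trans (by simp)⟩
    · exact (ih hb hc).cons (adj_of_contract_adj h ha hc)

/-- A walk that avoids `w` lifts edge by edge. Otherwise it is cut at the first visit to `w`, and
both pieces lift to walks ending at `u` or `v`, possibly at different ones; this is why the edge
`uv` does not enter the count. -/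
theorem walk_or_nearEdge_of_contract_walk (hw : w ∉ G.verts) {a b : ℕ}
    (q : (G.contract u v w).graph.Walk a b) (ha : a ≠ w) (hb : b ≠ w) :
    (∃ p : G.graph.Walk a b, p.length ≤ q.length) ∨
      ∃ m n, G.NearEdge u v a m ∧ G.NearEdge u v b n ∧ m + n ≤ q.length := by
  induction q with
  | nil => exact Or.inl ⟨.nil, le_rfl⟩
  | @cons a c b h q ih =>
    by_cases hc : c = w
    · subst hc
      refine Or.inr ⟨1, q.length, nearEdge_one (adj_of_contract_adj_new hw h), ?_, ?_⟩
      · rw [← SimpleGraph.Walk.length_reverse]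
        exact nearEdge_of_contract_walk hw q.reverse rfl hb
      · rw [SimpleGraph.Walk.length_cons]; omega
    · have hadj := adj_of_contract_adj h ha hc
      rcases ih hc hb with ⟨p, hp⟩ | ⟨m, n, hm, hn, hmn⟩
      · exact Or.inl ⟨.cons hadj p, by simpa using hp⟩
      · exact Or.inr ⟨m + 1, n, hm.cons hadj, hn, by rw [SimpleGraph.Walk.length_cons]; omega⟩

/-- Along the walk, `u` and `v` are renamed to `w`. Steps inside `{u, v}` disappear and all others
survive. -/
theorem exists_contract_walk (hw : w ∉ G.verts) {x y a b : ℕ} (p : G.graph.Walk x y)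
    (ha : a = if x = u ∨ x = v then w else x) (hb : b = if y = u ∨ y = v then w else y) :
    ∃ q : (G.contract u v w).graph.Walk a b, q.length ≤ p.length := by
  induction p generalizing a with
  | nil => subst ha hb; exact ⟨.nil, le_rfl⟩
  | @cons x c y h p ih =>
    by_cases hx : x = u ∨ x = v
    · rw [if_pos hx] at ha
      subst ha
      by_cases hc : c = u ∨ c = v
      · obtain ⟨q, hq⟩ := ih (if_pos hc).symm hb
        exact ⟨q, hq.trans (by simp)⟩
      · obtain ⟨q, hq⟩ := ih (if_neg hc).symm hb
        have : G.graph.Adj c u ∨ G.graph.Adj c v := by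
          rcases hx with rfl | rfl
          · exact Or.inl h.symm
          · exact Or.inr h.symm
        exact ⟨.cons (contract_adj_new hw this (not_or.1 hc)).symm q, by simpa using hq⟩
    · rw [if_neg hx] at ha
      subst ha
      by_cases hc : c = u ∨ c = v
      · obtain ⟨q, hq⟩ := ih (if_pos hc).symm hb
        have : G.graph.Adj a u ∨ G.graph.Adj a v := by
          rcases hc with rfl | rfl
          · exact Or.inl h
          · exact Or.inr h
        exact ⟨.cons (contract_adj_new hw this (not_or.1 hx)) q, by simpa using hq⟩
      · obtain ⟨q, hq⟩ := ih (if_neg hc).symm hb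
        exact ⟨.cons (contract_adj_of_adj h (not_or.1 hx) (not_or.1 hc)) q, by simpa using hq⟩

/-- The distance of `x` from the nearer of `u` and `v`. -/
noncomputable def edgeDist (G : FinGraph) (u v x : ℕ) : ℕ :=
  min (G.graph.dist x u) (G.graph.dist x v)

theorem NearEdge.reachable (huv : G.graph.Adj u v) {x n : ℕ} (h : G.NearEdge u v x n) :
    G.graph.Reachable x u := by
  rcases h with ⟨p, -⟩ | ⟨p, -⟩
  · exact ⟨p⟩
  · exact SimpleGraph.Reachable.trans ⟨p⟩ huv.symm.reachable

theorem NearEdge.edgeDist_le {x n : ℕ} (h : G.NearEdge u v x n) : G.edgeDist u v x ≤ n := by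
  rcases h with ⟨p, hp⟩ | ⟨p, hp⟩
  · exact (min_le_left _ _).trans ((SimpleGraph.dist_le p).trans hp)
  · exact (min_le_right _ _).trans ((SimpleGraph.dist_le p).trans hp)

theorem edgeDist_le_dist_add {x y : ℕ} (h : G.graph.Reachable x y) :
    G.edgeDist u v x ≤ G.graph.dist x y + G.edgeDist u v y := by
  have h1 := h.dist_triangle_left u
  have h2 := h.dist_triangle_left v
  simp only [edgeDist]
  omega

theorem dist_le_edgeDist_add (huv : G.graph.Adj u v) {x y : ℕ} (hx : G.graph.Reachable x u)
    (hy : G.graph.Reachable y u) :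
    G.graph.dist x y ≤ G.edgeDist u v x + G.edgeDist u v y + 1 := by
  have hxv := hx.trans huv.reachable
  have hyv := hy.trans huv.reachable
  have h1 := SimpleGraph.dist_eq_one_iff_adj.2 huv
  have h2 := hx.dist_triangle_left y
  have h3 := hxv.dist_triangle_left y
  have h4 := hy.symm.dist_triangle_right v
  have h5 := hyv.symm.dist_triangle_right u
  have h6 := huv.reachable.dist_triangle_left y
  have h7 := huv.symm.reachable.dist_triangle_left y
  rw [G.graph.dist_comm (u := v) (v := u)] at h7
  rw [G.graph.dist_comm (u := u) (v := y)] at *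
  rw [G.graph.dist_comm (u := v) (v := y)] at *
  simp only [edgeDist]
  omega

theorem contract_dist_new (hw : w ∉ G.verts) (huv : G.graph.Adj u v) {x : ℕ}
    (hx : x ∈ G.verts) (hxu : x ≠ u ∧ x ≠ v)
    (h : G.graph.Reachable x u) :
    (G.contract u v w).graph.Reachable x w ∧
      (G.contract u v w).graph.dist x w = G.edgeDist u v x := by
  have hxw : x ≠ w := by rintro rfl; exact hw hx
  obtain ⟨p, hp⟩ := h.exists_walk_length_eq_dist
  obtain ⟨p', hp'⟩ := (h.trans huv.reachable).exists_walk_length_eq_dist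
  obtain ⟨q, hq⟩ := exists_contract_walk (u := u) (v := v) (a := x) (b := w) hw p
    (by simp [hxu]) (by simp)
  obtain ⟨q', hq'⟩ := exists_contract_walk (u := u) (v := v) (a := x) (b := w) hw p'
    (by simp [hxu]) (by simp)
  refine ⟨⟨q⟩, le_antisymm (le_min ?_ ?_) ?_⟩
  · exact (SimpleGraph.dist_le q).trans (hq.trans hp.le)
  · exact (SimpleGraph.dist_le q').trans (hq'.trans hp'.le)
  · obtain ⟨r, hr⟩ := (SimpleGraph.Walk.reachable q).exists_walk_length_eq_dist
    rw [← hr]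
    exact (nearEdge_of_contract_walk hw r rfl hxw).edgeDist_le

theorem reachable_of_contract_reachable_new (hw : w ∉ G.verts) (huv : G.graph.Adj u v) {x : ℕ}
    (hxw : x ≠ w)
    (h : (G.contract u v w).graph.Reachable x w) : G.graph.Reachable x u := by
  obtain ⟨q⟩ := h
  exact (nearEdge_of_contract_walk hw q rfl hxw).reachable huv

theorem contract_reachable_iff (hw : w ∉ G.verts) (huv : G.graph.Adj u v) {x y : ℕ}
    (hx : x ∈ G.verts) (hxu : x ≠ u ∧ x ≠ v)
    (hy : y ∈ G.verts) (hyu : y ≠ u ∧ y ≠ v) :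
    (G.contract u v w).graph.Reachable x y ↔ G.graph.Reachable x y := by
  have hxw : x ≠ w := by rintro rfl; exact hw hx
  have hyw : y ≠ w := by rintro rfl; exact hw hy
  constructor
  · rintro ⟨q⟩
    rcases walk_or_nearEdge_of_contract_walk hw q hxw hyw with ⟨p, -⟩ | ⟨m, n, hm, hn, -⟩
    · exact ⟨p⟩
    · exact (hm.reachable huv).trans (hn.reachable huv).symm
  · rintro ⟨p⟩
    obtain ⟨q, -⟩ := exists_contract_walk (u := u) (v := v) (a := x) (b := y) hw p
      (by simp [hxu]) (by simp [hyu])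
    exact ⟨q⟩

theorem contract_dist_le (hw : w ∉ G.verts) {x y : ℕ}
    (hxu : x ≠ u ∧ x ≠ v)
    (hyu : y ≠ u ∧ y ≠ v) (h : G.graph.Reachable x y) :
    (G.contract u v w).graph.dist x y ≤ G.graph.dist x y := by
  obtain ⟨p, hp⟩ := h.exists_walk_length_eq_dist
  obtain ⟨q, hq⟩ := exists_contract_walk (u := u) (v := v) (a := x) (b := y) hw p
    (by simp [hxu]) (by simp [hyu])
  exact (SimpleGraph.dist_le q).trans (hq.trans hp.le)

/-- A shortest walk of the contraction either avoids `w` and lifts, or passes through `w` and pays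
for reaching the edge from both ends. -/
theorem contract_dist_eq_or (hw : w ∉ G.verts) (huv : G.graph.Adj u v) {x y : ℕ}
    (hx : x ∈ G.verts) (hxu : x ≠ u ∧ x ≠ v)
    (hyu : y ≠ u ∧ y ≠ v) (h : G.graph.Reachable x y) :
    (G.contract u v w).graph.dist x y = G.graph.dist x y ∨
      G.graph.Reachable x u ∧ G.edgeDist u v x + G.edgeDist u v y
        ≤ (G.contract u v w).graph.dist x y := by
  have hy := mem_verts_of_reachable hx h
  have hxw : x ≠ w := by rintro rfl; exact hw hx
  have hyw : y ≠ w := by rintro rfl; exact hw hy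
  obtain ⟨q, hq⟩ := ((contract_reachable_iff hw huv hx hxu hy hyu).2 h).exists_walk_length_eq_dist
  rw [← hq]
  rcases walk_or_nearEdge_of_contract_walk hw q hxw hyw with ⟨p, hp⟩ | ⟨m, n, hm, hn, hmn⟩
  · left
    refine le_antisymm ?_ ((SimpleGraph.dist_le p).trans hp)
    rw [hq]
    exact contract_dist_le hw hxu hyu h
  · exact Or.inr ⟨hm.reachable huv, (add_le_add hm.edgeDist_le hn.edgeDist_le).trans hmn⟩

/-- A walk through `w` lifts after inserting the edge `uv` at most once. -/
theorem dist_le_contract_dist_add_one (hw : w ∉ G.verts) (huv : G.graph.Adj u v) {x y : ℕ}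
    (hx : x ∈ G.verts) (hxu : x ≠ u ∧ x ≠ v)
    (hyu : y ≠ u ∧ y ≠ v) (h : G.graph.Reachable x y) :
    G.graph.dist x y ≤ (G.contract u v w).graph.dist x y + 1 := by
  rcases contract_dist_eq_or hw huv hx hxu hyu h with h1 | ⟨h1, h2⟩
  · omega
  · have := dist_le_edgeDist_add huv h1 (h.symm.trans h1)
    omega

end FinGraph

/-! ### The random walk produced by recursive splitting -/

/-- The uniform distribution on a finite set (a point mass at `0` if the set is empty). -/
noncomputable def uniformOn (S : Finset ℕ) : PMF ℕ :=
  if h : S.Nonempty then PMF.uniformOfFinset S h else PMF.pure 0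

theorem uniformOn_of_nonempty {S : Finset ℕ} (h : S.Nonempty) :
    uniformOn S = PMF.uniformOfFinset S h := dif_pos h

theorem support_uniformOn {S : Finset ℕ} (h : S.Nonempty) : (uniformOn S).support = S := by
  rw [uniformOn_of_nonempty h, PMF.support_uniformOfFinset]

theorem mem_support_uniformOn {S : Finset ℕ} (h : S.Nonempty) {a : ℕ} :
    a ∈ (uniformOn S).support ↔ a ∈ S := by
  rw [support_uniformOn h, Finset.mem_coe]

/-- The scales of the recursion; consecutive scales differ by a factor of about `5 / 4`. -/
def gap : ℕ → ℕ
  | 0 => 4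
  | j + 1 => gap j + gap j / 4

theorem four_le_gap (j : ℕ) : 4 ≤ gap j := by
  induction j with
  | zero => exact le_rfl
  | succ j ih => rw [gap]; omega

theorem gap_div_pos (j : ℕ) : 0 < gap j / 4 := by
  have := four_le_gap j
  omega

theorem gap_mono {i j : ℕ} (h : i ≤ j) : gap i ≤ gap j := by
  induction h with
  | refl => exact le_rfl
  | step _ ih => exact ih.trans (by rw [gap]; omega)

theorem gap_add_mul_le (j m : ℕ) : gap j + m * (gap j / 4) ≤ gap (j + m) := by
  induction m with
  | zero => simp
  | succ m ih =>
    have h1 := Nat.div_le_div_right (c := 4) (gap_mono (Nat.le_add_right j m))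
    rw [← add_assoc, gap, add_mul]
    omega

/-- Rounding leaves `8 * (gap j / 4) ≥ gap j` because `gap j ≥ 4`. This doubling time is the factor
8 in `AdjList.levels`. -/
theorem two_mul_gap_le (j : ℕ) : 2 * gap j ≤ gap (j + 8) := by
  have h := four_le_gap j
  have := gap_add_mul_le j 8
  omega

theorem two_pow_le_gap (i : ℕ) : 2 ^ i ≤ gap (8 * i) := by
  induction i with
  | zero => simp [gap]
  | succ i ih =>
    have := two_mul_gap_le (8 * i)
    rw [pow_succ, mul_add, mul_one]
    omega

/-! ### Candidate sets, canonical geodesics and the stretch of the random walk -/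

namespace FinGraph

variable (G : FinGraph)

open Classical in
/-- The vertices at distance at most `a` from `x` and at most `b` from `y`. -/
noncomputable def ellipse (x y a b : ℕ) : Finset ℕ :=
  G.verts.filter fun z => (G.graph.Reachable x z ∧ G.graph.dist x z ≤ a) ∧
    (G.graph.Reachable z y ∧ G.graph.dist z y ≤ b)

/-- The first vertex after `x` on the canonical shortest path from `x` to `y`. -/
noncomputable def hop (y x : ℕ) : ℕ :=
  ((G.ellipse x y 1 (G.graph.dist x y - 1)).sort (· ≤ ·)).headI

/-- The canonical shortest path from `x` to `y`. -/
noncomputable def geodesic (x y : ℕ) : List ℕ :=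
  (List.range (G.graph.dist x y + 1)).map fun i => (G.hop y)^[i] x

/-- A random walk from `x` to `y`: up to `j` times, segments are split at random vertices that lie
roughly between their end points, and finally the segments are replaced by shortest paths. -/
noncomputable def walkPMF (K : ℕ) : ℕ → ℕ → ℕ → PMF (List ℕ)
  | 0, x, y => PMF.pure (G.geodesic x y)
  | j + 1, x, y =>
    (uniformOn (Finset.range (K * (gap j / 4)))).bind fun i =>
      (uniformOn (Finset.range (gap j / 4))).bind fun i' =>
        if G.graph.dist x y ≤ 2 * (K * (gap j / 4)) + i then walkPMF K j x y
        else
          (uniformOn (G.ellipse x y (2 * (K * (gap j / 4)) + i + (gap j / 4 + 1 + i'))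
            (G.graph.dist x y - (2 * (K * (gap j / 4)) + i) + (gap j / 4 + 1 + i')))).bind fun z =>
          (walkPMF K j x z).bind fun P => (walkPMF K j z y).map fun Q => P ++ Q.tail

variable {G}

theorem mem_ellipse {x y a b z : ℕ} (hx : x ∈ G.verts) :
    z ∈ G.ellipse x y a b ↔ (G.graph.Reachable x z ∧ G.graph.dist x z ≤ a) ∧
      (G.graph.Reachable z y ∧ G.graph.dist z y ≤ b) := by
  simp only [ellipse, Finset.mem_filter]
  exact ⟨fun h => h.2, fun h => ⟨mem_verts_of_reachable hx h.1.1, h⟩⟩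

theorem ellipse_mono {x y a b a' b' : ℕ} (ha : a ≤ a') (hb : b ≤ b') :
    G.ellipse x y a b ⊆ G.ellipse x y a' b' := by
  intro z hz
  simp only [ellipse, Finset.mem_filter] at hz ⊢
  exact ⟨hz.1, ⟨hz.2.1.1, hz.2.1.2.trans ha⟩, hz.2.2.1, hz.2.2.2.trans hb⟩

theorem exists_dist_eq {x y i : ℕ} (h : G.graph.Reachable x y) (hi : i ≤ G.graph.dist x y) :
    ∃ z, G.graph.Reachable x z ∧ G.graph.dist x z = i ∧ G.graph.Reachable z y ∧
      G.graph.dist z y = G.graph.dist x y - i := by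
  obtain ⟨p, hp⟩ := h.exists_walk_length_eq_dist
  have h1 : G.graph.Reachable x (p.getVert i) := ⟨p.take i⟩
  have h2 : G.graph.Reachable (p.getVert i) y := ⟨p.drop i⟩
  have h3 := SimpleGraph.dist_le (p.take i)
  have h4 := SimpleGraph.dist_le (p.drop i)
  have h5 := h1.dist_triangle_left y
  rw [SimpleGraph.Walk.take_length] at h3
  rw [SimpleGraph.Walk.drop_length] at h4
  refine ⟨p.getVert i, h1, ?_, h2, ?_⟩ <;> omega

/-- The vertices of a shortest path at distances `R - τ, …, R` from `x` all qualify. The lower bound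
makes the three vertices `u`, `v`, `w` negligible among the candidates. -/
theorem lt_card_ellipse {x y R τ : ℕ} (hx : x ∈ G.verts) (h : G.graph.Reachable x y)
    (hR : R ≤ G.graph.dist x y) (hτ : τ ≤ R) :
    τ < (G.ellipse x y (R + τ) (G.graph.dist x y - R + τ)).card := by
  have key : ∀ i : ℕ, ∃ z, i ≤ G.graph.dist x y → G.graph.Reachable x z ∧ G.graph.dist x z = i ∧
      G.graph.Reachable z y ∧ G.graph.dist z y = G.graph.dist x y - i := by
    intro i
    by_cases hi : i ≤ G.graph.dist x y
    · obtain ⟨z, hz⟩ := exists_dist_eq h hi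
      exact ⟨z, fun _ => hz⟩
    · exact ⟨0, fun h => absurd h hi⟩
  choose f hf using key
  have hcard : (Finset.Icc (R - τ) R).card = τ + 1 := by
    rw [Nat.card_Icc]; omega
  rw [← Nat.succ_le_iff, Nat.succ_eq_add_one, ← hcard]
  refine Finset.card_le_card_of_injOn f ?_ ?_
  · intro i hi
    rw [Finset.mem_coe, Finset.mem_Icc] at hi
    obtain ⟨h1, h2, h3, h4⟩ := hf i (hi.2.trans hR)
    rw [Finset.mem_coe, mem_ellipse hx]
    refine ⟨⟨h1, ?_⟩, h3, ?_⟩ <;> omega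
  · intro i hi k hk hik
    rw [Finset.mem_coe, Finset.mem_Icc] at hi hk
    rw [← (hf i (hi.2.trans hR)).2.1, ← (hf k (hk.2.trans hR)).2.1, hik]

theorem ellipse_nonempty {x y R τ : ℕ} (hx : x ∈ G.verts) (h : G.graph.Reachable x y)
    (hR : R ≤ G.graph.dist x y) :
    (G.ellipse x y (R + τ) (G.graph.dist x y - R + τ)).Nonempty := by
  obtain ⟨z, h1, h2, h3, h4⟩ := exists_dist_eq h hR
  exact ⟨z, (mem_ellipse hx).2 ⟨⟨h1, by omega⟩, h3, by omega⟩⟩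

theorem headI_sort_mem {S : Finset ℕ} (h : S.Nonempty) : (S.sort (· ≤ ·)).headI ∈ S := by
  have h1 : S.sort (· ≤ ·) ≠ [] := by
    intro h0
    obtain ⟨a, ha⟩ := h
    have := (Finset.mem_sort (· ≤ ·)).2 ha
    rw [h0] at this
    simp at this
  rw [← Finset.mem_sort (· ≤ ·)]
  cases hl : S.sort (· ≤ ·) with
  | nil => exact absurd hl h1
  | cons a l => simp

theorem hop_spec {x y : ℕ} (hx : x ∈ G.verts) (h : G.graph.Reachable x y)
    (hd : 0 < G.graph.dist x y) :
    G.graph.Adj x (G.hop y x) ∧ G.graph.dist (G.hop y x) y + 1 = G.graph.dist x y := by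
  have hne : (G.ellipse x y 1 (G.graph.dist x y - 1)).Nonempty :=
    ellipse_nonempty (R := 1) (τ := 0) hx h hd
  obtain ⟨⟨h1, h2⟩, h3, h4⟩ := (mem_ellipse hx).1 (headI_sort_mem hne)
  have h5 := h1.dist_triangle_left y
  have h6 : G.graph.dist x (G.hop y x) = 1 := by
    unfold hop
    omega
  refine ⟨SimpleGraph.dist_eq_one_iff_adj.1 h6, ?_⟩
  unfold hop at *
  omega

theorem isWalkOfLength_geodesic {x y : ℕ} (hx : x ∈ G.verts) (h : G.graph.Reachable x y) :
    IsWalkOfLength G.graph x y (G.graph.dist x y) (G.geodesic x y) := by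
  have key : ∀ d x, x ∈ G.verts → G.graph.Reachable x y → G.graph.dist x y = d →
      ∃ p : G.graph.Walk x y,
        p.support = (List.range (d + 1)).map (fun i => (G.hop y)^[i] x) ∧ p.length = d := by
    intro d
    induction d with
    | zero =>
      intro x _ h hd
      obtain rfl := h.dist_eq_zero_iff.1 hd
      exact ⟨.nil, by simp, rfl⟩
    | succ d ih =>
      intro x hx h hd
      obtain ⟨h1, h2⟩ := hop_spec hx h (by omega)
      obtain ⟨p, hp, hp'⟩ := ih (G.hop y x) (G.mem_verts_of_adj h1.symm) (h1.symm.reachable.trans h)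
        (by omega)
      refine ⟨.cons h1 p, ?_, by simp [hp']⟩
      rw [SimpleGraph.Walk.support_cons, hp, List.range_succ_eq_map (n := d + 1), List.map_cons,
        List.map_map]
      rfl
  obtain ⟨p, hp, hp'⟩ := key _ x hx h rfl
  exact ⟨p, hp, by rw [hp']⟩

/-- A split adds at most `4T` to the distance and happens only if that distance exceeds `2KT`, so
each level stretches by a factor of at most `1 + 2/K`. -/
theorem isWalkOfLength_walkPMF {K : ℕ} (hK : 0 < K) (j : ℕ) :
    ∀ {x y : ℕ}, x ∈ G.verts → G.graph.Reachable x y → ∀ l ∈ (G.walkPMF K j x y).support,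
      IsWalkOfLength G.graph x y ((1 + 2 / (K : ℝ)) ^ j * G.graph.dist x y) l := by
  induction j with
  | zero =>
    intro x y hx h l hl
    rw [walkPMF, PMF.support_pure, Set.mem_singleton_iff] at hl
    subst hl
    simpa using isWalkOfLength_geodesic hx h
  | succ j ih =>
    intro x y hx h l hl
    have hT := gap_div_pos j
    have hK' : (0 : ℝ) < K := by exact_mod_cast hK
    have hρ : (1 : ℝ) ≤ 1 + 2 / (K : ℝ) := le_add_of_nonneg_right (by positivity)
    rw [walkPMF, PMF.mem_support_bind_iff] at hl
    obtain ⟨i, hi, hl⟩ := hl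
    rw [PMF.mem_support_bind_iff] at hl
    obtain ⟨i', hi', hl⟩ := hl
    rw [mem_support_uniformOn (Finset.nonempty_range_iff.2 hT.ne'), Finset.mem_range] at hi'
    split_ifs at hl with hd
    · refine (ih hx h l hl).mono ?_
      rw [pow_succ]
      gcongr
      exact le_mul_of_one_le_right (by positivity) hρ
    · have hd' := (not_le.1 hd).le
      rw [PMF.mem_support_bind_iff] at hl
      obtain ⟨z, hz, hl⟩ := hl
      rw [PMF.mem_support_bind_iff] at hl
      obtain ⟨P, hP, hl⟩ := hl
      rw [PMF.mem_support_map_iff] at hl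
      obtain ⟨Q, hQ, rfl⟩ := hl
      rw [mem_support_uniformOn (ellipse_nonempty hx h hd'), mem_ellipse hx] at hz
      obtain ⟨⟨hz1, hz2⟩, hz3, hz4⟩ := hz
      refine ((ih hx hz1 P hP).append (ih (mem_verts_of_reachable hx hz1) hz3 Q hQ)).mono ?_
      rw [← mul_add, pow_succ, mul_assoc]
      gcongr
      have e1 : G.graph.dist x z + G.graph.dist z y ≤ G.graph.dist x y + 4 * (gap j / 4) := by omega
      have e2 : 2 * (K * (gap j / 4)) ≤ G.graph.dist x y := by omega
      have e1' : (G.graph.dist x z : ℝ) + G.graph.dist z y ≤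
          G.graph.dist x y + 4 * (gap j / 4 : ℕ) := by
        exact_mod_cast e1
      have e2' : 2 * ((K : ℝ) * (gap j / 4 : ℕ)) ≤ G.graph.dist x y := by exact_mod_cast e2
      have e3 : 4 * ((gap j / 4 : ℕ) : ℝ) ≤ 2 / K * G.graph.dist x y := by
        rw [div_mul_eq_mul_div, le_div_iff₀ hK']
        linarith
      linarith

end FinGraph

/-! ### Contracting an edge far away from the walk -/

namespace FinGraph

variable {G : FinGraph} {u v w : ℕ}

/-- Every detour from `x` to `y` via the edge `{u, v}` is longer than `c`. -/
def Far (G : FinGraph) (u v c x y : ℕ) : Prop :=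
  G.graph.Reachable x u → c < G.edgeDist u v x + G.edgeDist u v y

theorem mem_contract_verts {z : ℕ} :
    z ∈ (G.contract u v w).verts ↔ z = w ∨ z ∈ G.verts ∧ z ≠ u ∧ z ≠ v := by
  simp [contract]

theorem Far.dist_eq (hw : w ∉ G.verts) (huv : G.graph.Adj u v) {x y : ℕ} (hx : x ∈ G.verts)
    (hxu : x ≠ u ∧ x ≠ v) (hyu : y ≠ u ∧ y ≠ v) (h : G.graph.Reachable x y)
    (hfar : G.Far u v (G.graph.dist x y) x y) :
    (G.contract u v w).graph.dist x y = G.graph.dist x y := by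
  rcases contract_dist_eq_or hw huv hx hxu hyu h with h1 | ⟨h1, h2⟩
  · exact h1
  · have := hfar h1
    have := contract_dist_le hw hxu hyu h
    omega

theorem Far.ne_of_mem_ellipse {x y a b z : ℕ} (huv : G.graph.Adj u v)
    (hx : x ∈ G.verts) (hfar : G.Far u v (a + b) x y)
    (hz : z ∈ G.ellipse x y a b) : z ≠ u ∧ z ≠ v := by
  obtain ⟨⟨h1, h2⟩, h3, h4⟩ := (mem_ellipse hx).1 hz
  rw [G.graph.dist_comm] at h4
  constructor
  · rintro rfl
    have h5 := hfar h1
    have h6 : G.edgeDist z v x ≤ _ := min_le_left _ _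
    have h7 : G.edgeDist z v y ≤ _ := min_le_left _ _
    omega
  · rintro rfl
    have h5 := hfar (h1.trans huv.symm.reachable)
    have h6 : G.edgeDist u z x ≤ _ := min_le_right _ _
    have h7 : G.edgeDist u z y ≤ _ := min_le_right _ _
    omega

/-- Any change of the set needs a vertex reached through `w` on at least one side, or `w` itself. By
the triangle inequality its distances to `x` and `y` would then sum to at least that of a detour
through the edge, which exceeds `a + b`. -/
theorem Far.ellipse_eq (hw : w ∉ G.verts) (huv : G.graph.Adj u v) {x y a b : ℕ} (hx : x ∈ G.verts)
    (hxu : x ≠ u ∧ x ≠ v) (hyu : y ≠ u ∧ y ≠ v) (h : G.graph.Reachable x y)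
    (hfar : G.Far u v (a + b) x y) :
    (G.contract u v w).ellipse x y a b = G.ellipse x y a b := by
  have hy := mem_verts_of_reachable hx h
  have hxV : x ∈ (G.contract u v w).verts := mem_contract_verts.2 (Or.inr ⟨hx, hxu⟩)
  have hxw : x ≠ w := by rintro rfl; exact hw hx
  have hyw : y ≠ w := by rintro rfl; exact hw hy
  ext z
  constructor
  · intro hz
    have hzV := hz
    simp only [ellipse, Finset.mem_filter] at hzV
    obtain ⟨⟨h1, h2⟩, h3, h4⟩ := (mem_ellipse hxV).1 hz
    rcases mem_contract_verts.1 hzV.1 with rfl | ⟨hzG, hzu⟩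
    · exfalso
      have hru := reachable_of_contract_reachable_new hw huv hxw h1
      have e1 := (contract_dist_new hw huv hx hxu hru).2
      have e2 := (contract_dist_new hw huv hy hyu (h.symm.trans hru)).2
      rw [(G.contract u v z).graph.dist_comm] at h4
      have := hfar hru
      omega
    · rw [contract_reachable_iff hw huv hx hxu hzG hzu] at h1
      rw [contract_reachable_iff hw huv hzG hzu hy hyu] at h3
      have key : ∀ hru : G.graph.Reachable x u, a + b < G.edgeDist u v x + G.edgeDist u v y :=
        fun hru => hfar hru
      rw [mem_ellipse hx]
      have t1 := edgeDist_le_dist_add (u := u) (v := v) h1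
      have t2 := edgeDist_le_dist_add (u := u) (v := v) h3.symm
      rw [G.graph.dist_comm] at t2
      rcases contract_dist_eq_or hw huv hx hxu hzu h1 with e1 | ⟨e1, e1'⟩
      · rcases contract_dist_eq_or hw huv hzG hzu hyu h3 with e2 | ⟨e2, e2'⟩
        · refine ⟨⟨h1, ?_⟩, h3, ?_⟩ <;> omega
        · have := key (h1.trans e2)
          omega
      · have := key e1
        rcases contract_dist_eq_or hw huv hzG hzu hyu h3 with e2 | ⟨e2, e2'⟩ <;> omega
  · intro hz
    have hzu := hfar.ne_of_mem_ellipse huv hx hz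
    obtain ⟨⟨h1, h2⟩, h3, h4⟩ := (mem_ellipse hx).1 hz
    have hzG := mem_verts_of_reachable hx h1
    rw [mem_ellipse hxV]
    exact ⟨⟨(contract_reachable_iff hw huv hx hxu hzG hzu).2 h1,
      (contract_dist_le hw hxu hzu h1).trans h2⟩,
      (contract_reachable_iff hw huv hzG hzu hy hyu).2 h3,
      (contract_dist_le hw hzu hyu h3).trans h4⟩

theorem Far.hop_eq (hw : w ∉ G.verts) (huv : G.graph.Adj u v) {x y : ℕ} (hx : x ∈ G.verts)
    (hxu : x ≠ u ∧ x ≠ v) (hyu : y ≠ u ∧ y ≠ v) (h : G.graph.Reachable x y)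
    (hd : 0 < G.graph.dist x y) (hfar : G.Far u v (G.graph.dist x y) x y) :
    (G.contract u v w).hop y x = G.hop y x := by
  rw [hop, hop, hfar.dist_eq hw huv hx hxu hyu h, Far.ellipse_eq hw huv hx hxu hyu h]
  rwa [Nat.add_sub_of_le (Nat.succ_le_of_lt hd)]

/-- Each hop is the least label in a candidate set that the contraction leaves unchanged. A hop
lowers the remaining distance by one and the distance to the edge by at most one, so farness
persists along the path. -/
theorem Far.geodesic_eq (hw : w ∉ G.verts) (huv : G.graph.Adj u v) {x y : ℕ} (hx : x ∈ G.verts)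
    (hxu : x ≠ u ∧ x ≠ v) (hyu : y ≠ u ∧ y ≠ v) (h : G.graph.Reachable x y)
    (hfar : G.Far u v (G.graph.dist x y) x y) :
    (G.contract u v w).geodesic x y = G.geodesic x y := by
  have key : ∀ i x, x ∈ G.verts → (x ≠ u ∧ x ≠ v) → G.graph.Reachable x y →
      G.Far u v (G.graph.dist x y) x y → i ≤ G.graph.dist x y →
      ((G.contract u v w).hop y)^[i] x = (G.hop y)^[i] x := by
    intro i
    induction i with
    | zero => intros; rfl
    | succ i ih =>
      intro x hx hxu h hfar hi
      have hd : 0 < G.graph.dist x y := by omega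
      obtain ⟨h1, h2⟩ := hop_spec hx h hd
      have hxz := SimpleGraph.dist_eq_one_iff_adj.2 h1
      have hfar1 : G.Far u v (1 + (G.graph.dist x y - 1)) x y := by
        rwa [Nat.add_sub_of_le (Nat.succ_le_of_lt hd)]
      have hz : G.hop y x ∈ G.ellipse x y 1 (G.graph.dist x y - 1) :=
        (mem_ellipse hx).2 ⟨⟨h1.reachable, hxz.le⟩, h1.symm.reachable.trans h, by omega⟩
      rw [Function.iterate_succ_apply, Function.iterate_succ_apply,
        hfar.hop_eq hw huv hx hxu hyu h hd]
      refine ih _ (G.mem_verts_of_adj h1.symm) (hfar1.ne_of_mem_ellipse huv hx hz)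
        (h1.symm.reachable.trans h) ?_ (by omega)
      intro hru
      have e1 := hfar (h1.reachable.trans hru)
      have e2 := edgeDist_le_dist_add (u := u) (v := v) h1.reachable
      omega
  rw [geodesic, geodesic, hfar.dist_eq hw huv hx hxu hyu h]
  refine List.map_congr_left fun i hi => ?_
  rw [List.mem_range] at hi
  exact key i x hx hxu h hfar (by omega)

theorem Far.mono {c c' x y : ℕ} (h : G.Far u v c x y) (hc : c' ≤ c) : G.Far u v c' x y :=
  fun hru => hc.trans_lt (h hru)

/-- If the edge `{u, v}` is far away from the segment from `x` to `y`, then it is far away from the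
two parts of a split segment as well. -/
theorem Far.split {c c' τ x y z : ℕ} (h1 : G.graph.Reachable x z) (h2 : G.graph.Reachable z y)
    (hz : G.graph.dist x z + G.graph.dist z y ≤ G.graph.dist x y + τ)
    (hfar : G.Far u v (G.graph.dist x y + c) x y) (hc : c' + τ ≤ c) :
    G.Far u v (G.graph.dist x z + c') x z ∧ G.Far u v (G.graph.dist z y + c') z y := by
  have t1 := edgeDist_le_dist_add (u := u) (v := v) h1
  have t2 := edgeDist_le_dist_add (u := u) (v := v) h2.symm
  rw [G.graph.dist_comm] at t2
  constructor
  · intro hru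
    have := hfar hru
    omega
  · intro hru
    have := hfar (h1.trans hru)
    omega

/-- The margin `4 * gap (j + 1)` equals `4 * gap j + 4 * (gap j / 4)`. The second summand pays for
the slack `2τ` of one split, and the first is what the recursion needs. -/
theorem Far.walkPMF_eq (hw : w ∉ G.verts) (huv : G.graph.Adj u v) (K j : ℕ) :
    ∀ {x y : ℕ}, x ∈ G.verts → (x ≠ u ∧ x ≠ v) → (y ≠ u ∧ y ≠ v) → G.graph.Reachable x y →
      G.Far u v (G.graph.dist x y + 4 * gap j) x y →
      (G.contract u v w).walkPMF K j x y = G.walkPMF K j x y := by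
  induction j with
  | zero =>
    intro x y hx hxu hyu h hfar
    rw [walkPMF, walkPMF, (hfar.mono (Nat.le_add_right _ _)).geodesic_eq hw huv hx hxu hyu h]
  | succ j ih =>
    intro x y hx hxu hyu h hfar
    have hT := gap_div_pos j
    have hgap : gap (j + 1) = gap j + gap j / 4 := rfl
    rw [walkPMF, walkPMF, (hfar.mono (Nat.le_add_right _ _)).dist_eq hw huv hx hxu hyu h]
    refine congrArg _ (funext fun i => ?_)
    refine PMF.bind_congr_support _ fun i' hi' => ?_
    rw [mem_support_uniformOn (Finset.nonempty_range_iff.2 hT.ne'), Finset.mem_range] at hi'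
    split_ifs with hd
    · exact ih hx hxu hyu h (hfar.mono (by omega))
    · have hfar1 := hfar.mono (c' := 2 * (K * (gap j / 4)) + i + (gap j / 4 + 1 + i') +
        (G.graph.dist x y - (2 * (K * (gap j / 4)) + i) + (gap j / 4 + 1 + i'))) (by omega)
      rw [hfar1.ellipse_eq hw huv hx hxu hyu h]
      refine PMF.bind_congr_support _ fun z hz => ?_
      rw [mem_support_uniformOn (ellipse_nonempty hx h (not_le.1 hd).le)] at hz
      have hzu := hfar1.ne_of_mem_ellipse huv hx hz
      obtain ⟨⟨h1, h2⟩, h3, h4⟩ := (mem_ellipse hx).1 hz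
      obtain ⟨f1, f2⟩ := Far.split (c' := 4 * gap j) (τ := 4 * (gap j / 4)) h1 h3 (by omega) hfar
        (by omega)
      rw [ih hx hxu hzu h1 f1, ih (mem_verts_of_reachable hx h1) hzu hyu h3 f2]

end FinGraph

/-! ### Sensitivity of the random walk -/

/-- Both uniform distributions dominate the mass `1 / max |S| |S'|` on each point of `S ∩ S'`, which
serves as their common part. -/
theorem TransportLE.uniformOn_bind {κ : List ℕ → List ℕ → ℝ≥0∞} {f g : ℕ → PMF (List ℕ)}
    {S S' : Finset ℕ} (hS : S.Nonempty) (hS' : S'.Nonempty) {c B η : ℝ} (hc : 0 ≤ c) (hB : 0 ≤ B)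
    (hη : 1 - ((S ∩ S').card : ℝ) / (max S.card S'.card : ℕ) ≤ η)
    (h : ∀ z ∈ S ∩ S', TransportLE κ (f z) (g z) (ENNReal.ofReal c))
    (h' : ∀ a ∈ S, ∀ b ∈ S', TransportLE κ (f a) (g b) (ENNReal.ofReal B)) :
    TransportLE κ ((uniformOn S).bind f) ((uniformOn S').bind g) (ENNReal.ofReal (c + η * B)) := by
  classical
  have hM : 0 < max S.card S'.card := lt_max_of_lt_left hS.card_pos
  set M := max S.card S'.card with hMdef
  have hinv : ∀ {T : Finset ℕ}, T.card ≤ M → (M : ℝ≥0∞)⁻¹ ≤ (T.card : ℝ≥0∞)⁻¹ := by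
    intro T hT
    exact ENNReal.inv_le_inv.2 (by exact_mod_cast hT)
  have key := TransportLE.bind_of_common (κ := κ) (f := f) (g := g) (p := uniformOn S)
    (q := uniformOn S') (m := fun z => if z ∈ S ∩ S' then (M : ℝ≥0∞)⁻¹ else 0)
    (c := ENNReal.ofReal c) (B := ENNReal.ofReal B) ?_ ?_ ?_ ?_
  · refine key.mono ?_
    have hcard : (S ∩ S').card ≤ M :=
      (Finset.card_le_card Finset.inter_subset_left).trans (le_max_left _ _)
    have hMr : (0 : ℝ) < M := by exact_mod_cast hM
    have hsum : ∑' z, (if z ∈ S ∩ S' then (M : ℝ≥0∞)⁻¹ else 0)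
        = ENNReal.ofReal (((S ∩ S').card : ℝ) / M) := by
      rw [tsum_eq_sum (s := S ∩ S') (fun z hz => if_neg hz), Finset.sum_congr rfl
        (fun z hz => if_pos hz), Finset.sum_const, nsmul_eq_mul, ENNReal.ofReal_div_of_pos hMr,
        ENNReal.ofReal_natCast, ENNReal.ofReal_natCast, ENNReal.div_eq_inv_mul, mul_comm]
    have hle : ((S ∩ S').card : ℝ) / M ≤ 1 := by
      rw [div_le_one hMr]; exact_mod_cast hcard
    have hη0 : 0 ≤ η := le_trans (by linarith) hη
    rw [hsum, ENNReal.ofReal_add hc (by positivity), ENNReal.ofReal_mul hη0]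
    gcongr
    rw [← ENNReal.ofReal_one, ← ENNReal.ofReal_sub _ (by positivity)]
    exact ENNReal.ofReal_le_ofReal hη
  · intro z
    split_ifs with hz
    · rw [uniformOn_of_nonempty hS, PMF.uniformOfFinset_apply_of_mem hS (Finset.mem_inter.1 hz).1]
      exact hinv (le_max_left _ _)
    · exact zero_le
  · intro z
    split_ifs with hz
    · rw [uniformOn_of_nonempty hS', PMF.uniformOfFinset_apply_of_mem hS' (Finset.mem_inter.1 hz).2]
      exact hinv (le_max_right _ _)
    · exact zero_le
  · intro z hz
    refine h z ?_
    by_contra hz'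
    exact hz (if_neg hz')
  · intro a ha b hb
    exact h' a ((mem_support_uniformOn hS).1 ha) b ((mem_support_uniformOn hS').1 hb)

theorem TransportLE.uniformOn_range_bind {κ : List ℕ → List ℕ → ℝ≥0∞} {f g : ℕ → PMF (List ℕ)}
    {N : ℕ} (hN : 0 < N) {c : ℕ → ℝ} (hc : ∀ i < N, 0 ≤ c i)
    (h : ∀ i < N, TransportLE κ (f i) (g i) (ENNReal.ofReal (c i))) :
    TransportLE κ ((uniformOn (Finset.range N)).bind f) ((uniformOn (Finset.range N)).bind g)
      (ENNReal.ofReal ((∑ i ∈ Finset.range N, c i) / N)) := by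
  have hne : (Finset.range N).Nonempty := Finset.nonempty_range_iff.2 hN.ne'
  refine (TransportLE.bind_same _ (fun i => ENNReal.ofReal (c i)) fun i hi => h i ?_).mono ?_
  · rwa [mem_support_uniformOn hne, Finset.mem_range] at hi
  · have hNr : (0 : ℝ) < N := by exact_mod_cast hN
    rw [ENNReal.ofReal_div_of_pos hNr, ENNReal.ofReal_sum_of_nonneg
      (fun i hi => hc i (Finset.mem_range.1 hi)), ENNReal.ofReal_natCast, ENNReal.div_eq_inv_mul,
      Finset.mul_sum, tsum_eq_sum (s := Finset.range N)]
    · refine Finset.sum_le_sum fun i hi => ?_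
      rw [uniformOn_of_nonempty hne, PMF.uniformOfFinset_apply_of_mem hne hi, Finset.card_range]
    · intro i hi
      rw [uniformOn_of_nonempty hne, PMF.uniformOfFinset_apply_of_notMem hne hi, zero_mul]

namespace FinGraph

variable {G : FinGraph} {u v w : ℕ}

theorem ellipse_subset_verts (x y a b : ℕ) : G.ellipse x y a b ⊆ G.verts := by
  intro z hz
  simp only [ellipse, Finset.mem_filter] at hz
  exact hz.1

/-- The candidate sets before and after a contraction overlap substantially. -/
theorem one_sub_card_inter_div_le (hw : w ∉ G.verts) (huv : G.graph.Adj u v) {x y R τ T : ℕ}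
    (hx : x ∈ G.verts) (hxu : x ≠ u ∧ x ≠ v) (hyu : y ≠ u ∧ y ≠ v) (h : G.graph.Reachable x y)
    (hR : R < (G.contract u v w).graph.dist x y) (hT : 0 < T) (hTτ : T ≤ τ) (hτR : τ < R) :
    1 - ((G.ellipse x y (R + τ) (G.graph.dist x y - R + τ) ∩
        (G.contract u v w).ellipse x y (R + τ)
          ((G.contract u v w).graph.dist x y - R + τ)).card : ℝ) /
        (max (G.ellipse x y (R + τ) (G.graph.dist x y - R + τ)).card
          ((G.contract u v w).ellipse x y (R + τ)
            ((G.contract u v w).graph.dist x y - R + τ)).card : ℕ)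
      ≤ Real.log ((G.ellipse x y (R + (τ + 1)) (G.graph.dist x y - R + (τ + 1))).card + 1)
        - Real.log ((G.ellipse x y (R + (τ - 1)) (G.graph.dist x y - R + (τ - 1))).card + 1)
        + 3 / T := by
  have hy := mem_verts_of_reachable hx h
  have hxV : x ∈ (G.contract u v w).verts := mem_contract_verts.2 (Or.inr ⟨hx, hxu⟩)
  have hL := contract_dist_le hw hxu hyu h
  have hL' := dist_le_contract_dist_add_one hw huv hx hxu hyu h
  set S := G.ellipse x y (R + τ) (G.graph.dist x y - R + τ) with hS
  set S' := (G.contract u v w).ellipse x y (R + τ)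
    ((G.contract u v w).graph.dist x y - R + τ) with hS'
  set A := G.ellipse x y (R + (τ + 1)) (G.graph.dist x y - R + (τ + 1)) with hA
  set B := G.ellipse x y (R + (τ - 1)) (G.graph.dist x y - R + (τ - 1)) with hB
  have hSA : S ⊆ A := ellipse_mono (by omega) (by omega)
  have hBS : B ⊆ S := ellipse_mono (by omega) (by omega)
  -- Lifting to `G` raises each of the two distances by at most one, which the slack `τ + 1`
  -- permits.
  have hS'A : S' ⊆ insert w A := by
    intro z hz
    have hzV := hz
    simp only [hS', ellipse, Finset.mem_filter] at hzV
    obtain ⟨⟨h1, h2⟩, h3, h4⟩ := (mem_ellipse hxV).1 hz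
    rcases mem_contract_verts.1 hzV.1 with rfl | ⟨hzG, hzu⟩
    · exact Finset.mem_insert_self _ _
    · rw [contract_reachable_iff hw huv hx hxu hzG hzu] at h1
      rw [contract_reachable_iff hw huv hzG hzu hy hyu] at h3
      have e1 := dist_le_contract_dist_add_one hw huv hx hxu hzu h1
      have e2 := dist_le_contract_dist_add_one hw huv hzG hzu hyu h3
      refine Finset.mem_insert_of_mem ((mem_ellipse hx).2 ⟨⟨h1, ?_⟩, h3, ?_⟩) <;> omega
  -- Distances to `z` do not grow, but the bound on `d(z,y)` may be one smaller after the
  -- contraction; the slack `τ - 1` pays for this.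
  have hBS' : B \ {u, v} ⊆ S ∩ S' := by
    intro z hz
    rw [Finset.mem_sdiff, Finset.mem_insert, Finset.mem_singleton, not_or] at hz
    obtain ⟨hzB, hzu⟩ := hz
    rw [Finset.mem_inter]
    refine ⟨hBS hzB, ?_⟩
    obtain ⟨⟨h1, h2⟩, h3, h4⟩ := (mem_ellipse hx).1 hzB
    have hzG := mem_verts_of_reachable hx h1
    have e1 := contract_dist_le hw hxu hzu h1
    have e2 := contract_dist_le hw hzu hyu h3
    rw [hS', mem_ellipse hxV]
    refine ⟨⟨(contract_reachable_iff hw huv hx hxu hzG hzu).2 h1, ?_⟩,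
      (contract_reachable_iff hw huv hzG hzu hy hyu).2 h3, ?_⟩ <;> omega
  have c1 : max S.card S'.card ≤ A.card + 1 :=
    max_le ((Finset.card_le_card hSA).trans (Nat.le_succ _))
      ((Finset.card_le_card hS'A).trans (Finset.card_insert_le _ _))
  have c2 : B.card ≤ (S ∩ S').card + 2 := by
    have e1 := Finset.card_le_card hBS'
    have e2 := Finset.le_card_sdiff {u, v} B
    have e3 : ({u, v} : Finset ℕ).card ≤ 2 := Finset.card_le_two
    omega
  have c3 : T < A.card :=
    lt_of_le_of_lt (by omega) (lt_card_ellipse (τ := τ + 1) hx h (by omega) (by omega))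
  have c4 : 0 < max S.card S'.card := by
    refine lt_max_of_lt_left (lt_of_le_of_lt (Nat.zero_le τ) ?_)
    exact lt_card_ellipse hx h (by omega) hτR.le
  set M := max S.card S'.card
  have r1 : (M : ℝ) ≤ A.card + 1 := by exact_mod_cast c1
  have r2 : (B.card : ℝ) ≤ (S ∩ S').card + 2 := by exact_mod_cast c2
  have r3 : (T : ℝ) ≤ A.card + 1 := by
    have : (T : ℝ) < A.card := by exact_mod_cast c3
    linarith
  have r4 : (0 : ℝ) < M := by exact_mod_cast c4
  have r5 : (0 : ℝ) < T := by exact_mod_cast hT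
  have hApos : (0 : ℝ) < A.card + 1 := by positivity
  have hBpos : (0 : ℝ) < B.card + 1 := by positivity
  have s1 : ((S ∩ S').card : ℝ) / (A.card + 1) ≤ (S ∩ S').card / M := by gcongr
  -- Of the 3, two account for `u` and `v` and one for the `+ 1` inside the logarithm of `B.card +
  -- 1`.
  have s2 : ((B.card : ℝ) + 1) / (A.card + 1) - 3 / (A.card + 1) ≤
      (S ∩ S').card / ((A.card : ℝ) + 1) := by
    rw [← sub_div]
    gcongr
    linarith
  have s3 : 3 / ((A.card : ℝ) + 1) ≤ 3 / T := by gcongr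
  -- The bound `1 - 1/r ≤ log r` turns the ratio of sizes into a difference that telescopes over
  -- `τ`.
  have s4 : 1 - ((B.card : ℝ) + 1) / (A.card + 1) ≤
      Real.log (A.card + 1) - Real.log (B.card + 1) := by
    rw [← Real.log_div hApos.ne' hBpos.ne']
    have := Real.one_sub_inv_le_log_of_pos (x := ((A.card : ℝ) + 1) / (B.card + 1)) (by positivity)
    rwa [inv_div] at this
  linarith

/-- Differences over two steps are sums of two consecutive differences, so two telescoping sums
arise, each at most the logarithm for the whole vertex set. -/
theorem sum_log_card_ellipse_le (x y R L T : ℕ) :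
    ∑ i ∈ Finset.range T,
      (Real.log ((G.ellipse x y (R + (T + 1 + i + 1)) (L + (T + 1 + i + 1))).card + 1)
      - Real.log ((G.ellipse x y (R + (T + 1 + i - 1)) (L + (T + 1 + i - 1))).card + 1))
      ≤ 2 * Real.log (G.verts.card + 1) := by
  set g : ℕ → ℝ := fun m => Real.log ((G.ellipse x y (R + (T + m)) (L + (T + m))).card + 1) with hg
  have h0 : ∀ m, 0 ≤ g m := fun m => Real.log_nonneg (by simp)
  have h1 : ∀ m, g m ≤ Real.log (G.verts.card + 1) := by
    intro m
    refine Real.log_le_log (by positivity) ?_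
    have : (G.ellipse x y (R + (T + m)) (L + (T + m))).card ≤ G.verts.card :=
      Finset.card_le_card (ellipse_subset_verts _ _ _ _)
    gcongr
  have e : ∀ i ∈ Finset.range T,
      (Real.log ((G.ellipse x y (R + (T + 1 + i + 1)) (L + (T + 1 + i + 1))).card + 1)
      - Real.log ((G.ellipse x y (R + (T + 1 + i - 1)) (L + (T + 1 + i - 1))).card + 1))
      = (g (i + 1 + 1) - g (i + 1)) + (g (i + 1) - g i) := by
    intro i _
    have e1 : T + 1 + i + 1 = T + (i + 1 + 1) := by omega
    have e2 : T + 1 + i - 1 = T + i := by omega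
    rw [e1, e2]
    simp only [hg]
    ring
  rw [Finset.sum_congr rfl e, Finset.sum_add_distrib, Finset.sum_range_sub g T,
    Finset.sum_range_sub (fun i => g (i + 1)) T]
  linarith [h0 0, h0 1, h1 T, h1 (T + 1), h0 (0 + 1)]

end FinGraph

/-! ### The recursive estimate of the transport cost -/

namespace FinGraph

variable {G : FinGraph} {u v w : ℕ}

/-- The cost function of the earth mover's distance. -/
noncomputable def walkCost (l l' : List ℕ) : ℝ≥0∞ := (walkDist l l' : ℝ≥0∞)

/-- If the edge `{u, v}` is far away from neither part of a segment split at `z`, then the position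
of the split is close to that of the edge. -/
theorem near_of_not_far (huv : G.graph.Adj u v) {x y z a b c : ℕ}
    (h2 : G.graph.Reachable z y) (ha : G.graph.dist x z ≤ a) (hb : G.graph.dist z y ≤ b)
    (hf1 : ¬ G.Far u v (G.graph.dist x z + c) x z) (hf2 : ¬ G.Far u v (G.graph.dist z y + c) z y) :
    G.edgeDist u v x ≤ a + c ∧ G.graph.dist x y ≤ G.edgeDist u v x + b + c + 1 := by
  simp only [Far, not_forall, not_lt] at hf1 hf2
  obtain ⟨r1, e1⟩ := hf1
  obtain ⟨r2, e2⟩ := hf2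
  have := dist_le_edgeDist_add huv r1 (h2.symm.trans r2)
  omega

theorem card_filter_near_le (U A B a : ℕ) :
    ((Finset.range U).filter fun i => a ≤ B + i + A ∧ B + i ≤ a + A + 1).card ≤ 2 * A + 2 := by
  calc ((Finset.range U).filter fun i => a ≤ B + i + A ∧ B + i ≤ a + A + 1).card
      ≤ (Finset.Icc (a - A) (a + A + 1)).card := by
        refine Finset.card_le_card_of_injOn (fun i => B + i) ?_ ?_
        · intro i hi
          rw [Finset.mem_coe, Finset.mem_filter] at hi
          rw [Finset.mem_coe, Finset.mem_Icc]
          dsimp only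
          omega
        · intro i _ k _ hik
          exact Nat.add_left_cancel hik
    _ ≤ 2 * A + 2 := by rw [Nat.card_Icc]; omega

/-- A part far from the edge has the same distribution in both graphs and is coupled at no cost.
Only if neither part is far, which forces `P`, is the bound `H` paid twice. -/
theorem transport_walkPMF_of_split {K j : ℕ} (hK : 0 < K) {H : ℝ} (hH : 0 ≤ H)
    (hw : w ∉ G.verts) (huv : G.graph.Adj u v)
    {x y z : ℕ} (hx : x ∈ G.verts) (hxu : x ≠ u ∧ x ≠ v) (hyu : y ≠ u ∧ y ≠ v)
    (hzu : z ≠ u ∧ z ≠ v)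
    (h1 : G.graph.Reachable x z) (h2 : G.graph.Reachable z y)
    (t1 : TransportLE walkCost (G.walkPMF K j x z) ((G.contract u v w).walkPMF K j x z)
      (ENNReal.ofReal H))
    (t2 : TransportLE walkCost (G.walkPMF K j z y) ((G.contract u v w).walkPMF K j z y)
      (ENNReal.ofReal H)) (P : Prop) [Decidable P]
    (hP : ¬ G.Far u v (G.graph.dist x z + 4 * gap j) x z →
      ¬ G.Far u v (G.graph.dist z y + 4 * gap j) z y → P) :
    TransportLE walkCost
      ((G.walkPMF K j x z).bind fun P => (G.walkPMF K j z y).map fun Q => P ++ Q.tail)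
      (((G.contract u v w).walkPMF K j x z).bind fun P =>
        ((G.contract u v w).walkPMF K j z y).map fun Q => P ++ Q.tail)
      (ENNReal.ofReal (H + if P then H else 0)) := by
  have hz := mem_verts_of_reachable hx h1
  have hy := mem_verts_of_reachable hz h2
  have key : ∀ {c₁ c₂ : ℝ≥0∞},
      TransportLE walkCost (G.walkPMF K j x z) ((G.contract u v w).walkPMF K j x z) c₁ →
      TransportLE walkCost (G.walkPMF K j z y) ((G.contract u v w).walkPMF K j z y) c₂ →
      TransportLE walkCost
        ((G.walkPMF K j x z).bind fun P => (G.walkPMF K j z y).map fun Q => P ++ Q.tail)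
        (((G.contract u v w).walkPMF K j x z).bind fun P =>
          ((G.contract u v w).walkPMF K j z y).map fun Q => P ++ Q.tail) (c₁ + c₂) := by
    intro c₁ c₂ d1 d2
    refine d1.combine d2 _ _ fun l₁ hl₁ l₃ hl₃ l₂ hl₂ l₄ hl₄ => ?_
    have hxV : x ∈ (G.contract u v w).verts := mem_contract_verts.2 (Or.inr ⟨hx, hxu⟩)
    have hzV : z ∈ (G.contract u v w).verts := mem_contract_verts.2 (Or.inr ⟨hz, hzu⟩)
    have := walkDist_append_le (isWalkOfLength_walkPMF hK j hx h1 _ hl₁)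
      (isWalkOfLength_walkPMF hK j hz h2 _ hl₂)
      (isWalkOfLength_walkPMF hK j hxV
        ((contract_reachable_iff hw huv hx hxu hz hzu).2 h1) _ hl₃)
      (isWalkOfLength_walkPMF hK j hzV
        ((contract_reachable_iff hw huv hz hzu hy hyu).2 h2) _ hl₄)
    simp only [walkCost]
    exact_mod_cast this
  have hrefl : ∀ p : PMF (List ℕ), TransportLE walkCost p p 0 :=
    TransportLE.refl fun a => by simp [walkCost, walkDist_self]
  have hle : ENNReal.ofReal H ≤ ENNReal.ofReal (H + if P then H else 0) := by
    refine ENNReal.ofReal_le_ofReal ?_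
    split_ifs <;> linarith
  by_cases f1 : G.Far u v (G.graph.dist x z + 4 * gap j) x z
  · have t1' := hrefl (G.walkPMF K j x z)
    nth_rewrite 2 [← f1.walkPMF_eq hw huv K j hx hxu hzu h1] at t1'
    exact (key t1' t2).mono (by rwa [zero_add])
  by_cases f2 : G.Far u v (G.graph.dist z y + 4 * gap j) z y
  · have t2' := hrefl (G.walkPMF K j z y)
    nth_rewrite 2 [← f2.walkPMF_eq hw huv K j hz hzu hyu h2] at t2'
    exact (key t1 t2').mono (by rwa [add_zero])
  · refine (key t1 t2).mono ?_
    rw [if_pos (hP f1 f2), ENNReal.ofReal_add hH hH]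

/-- The bound solves the recursion `H (j+1) = (1 + 70/K) H j + β`. The factor comes from positions
at which both parts feel the edge, while `β` collects the failed couplings of the split vertex and
the change of the test whether to split. -/
theorem transport_walkPMF (hw : w ∉ G.verts) (huv : G.graph.Adj u v) {K J : ℕ} (hK : 2 ≤ K)
    (hKJ : (1 + 2 / (K : ℝ)) ^ J ≤ 2) {β : ℝ}
    (hβ : 36 + 36 * K * (2 * Real.log (G.verts.card + 1) + 3) ≤ β) (j : ℕ) (hj : j ≤ J) :
    ∀ {x y : ℕ}, x ∈ G.verts → (x ≠ u ∧ x ≠ v) → (y ≠ u ∧ y ≠ v) → G.graph.Reachable x y →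
      G.graph.dist x y ≤ K * gap j →
      TransportLE walkCost (G.walkPMF K j x y) ((G.contract u v w).walkPMF K j x y)
        (ENNReal.ofReal (β * (j + 1) * (1 + 70 / (K : ℝ)) ^ j)) := by
  have hK0 : 0 < K := by omega
  have hKr : (2 : ℝ) ≤ K := by exact_mod_cast hK
  have hlog : 0 ≤ Real.log (G.verts.card + 1) := Real.log_nonneg (by simp)
  have hβ0 : 8 * K ≤ β := by nlinarith
  have hρ : ∀ i ≤ J, (1 + 2 / (K : ℝ)) ^ i ≤ 2 := fun i hi =>
    (pow_le_pow_right₀ (le_add_of_nonneg_right (by positivity)) hi).trans hKJ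
  -- the trivial bound on the cost
  have htriv : ∀ i ≤ J, ∀ {x y : ℕ}, x ∈ G.verts → (x ≠ u ∧ x ≠ v) → (y ≠ u ∧ y ≠ v) →
      G.graph.Reachable x y → G.graph.dist x y ≤ K * gap i →
      ∀ l ∈ (G.walkPMF K i x y).support, ∀ l' ∈ ((G.contract u v w).walkPMF K i x y).support,
        walkCost l l' ≤ ENNReal.ofReal (4 * (K * gap i : ℕ)) := by
    intro i hi x y hx hxu hyu h hd l hl l' hl'
    have hxV : x ∈ (G.contract u v w).verts := mem_contract_verts.2 (Or.inr ⟨hx, hxu⟩)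
    have e1 := isWalkOfLength_walkPMF hK0 i hx h l hl
    have e2 := isWalkOfLength_walkPMF hK0 i hxV ((contract_reachable_iff hw huv hx hxu
      (mem_verts_of_reachable hx h) hyu).2 h) l' hl'
    refine (walkDist_le_add e1 e2).trans (ENNReal.ofReal_le_ofReal ?_)
    have e3 : (G.graph.dist x y : ℝ) ≤ (K * gap i : ℕ) := by exact_mod_cast hd
    have e4 : ((G.contract u v w).graph.dist x y : ℝ) ≤ (K * gap i : ℕ) := by
      exact_mod_cast (contract_dist_le hw hxu hyu h).trans hd
    have e5 := hρ i hi
    have e6 : (1 + 2 / (K : ℝ)) ^ i * G.graph.dist x y ≤ 2 * (K * gap i : ℕ) := by gcongr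
    have e7 : (1 + 2 / (K : ℝ)) ^ i * (G.contract u v w).graph.dist x y ≤ 2 * (K * gap i : ℕ) := by
      gcongr
    linarith
  induction j with
  | zero =>
    intro x y hx hxu hyu h hd
    refine (TransportLE.of_forall_le (htriv 0 hj hx hxu hyu h hd)).mono ?_
    refine ENNReal.ofReal_le_ofReal ?_
    have : 4 * ((K * gap 0 : ℕ) : ℝ) ≤ 36 * K * 3 := by
      simp only [gap]; push_cast; linarith
    have : 0 ≤ 36 * K * (2 * Real.log (G.verts.card + 1)) := by positivity
    simp only [Nat.cast_zero, zero_add, mul_one, pow_zero]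
    linarith
  | succ j ih =>
    intro x y hx hxu hyu h hd
    have ih := @ih (by omega)
    have hT := gap_div_pos j
    have hxV : x ∈ (G.contract u v w).verts := mem_contract_verts.2 (Or.inr ⟨hx, hxu⟩)
    have hy := mem_verts_of_reachable hx h
    have h' := (contract_reachable_iff hw huv hx hxu hy hyu).2 h
    have hL := contract_dist_le hw hxu hyu h
    have hL' := dist_le_contract_dist_add_one hw huv hx hxu hyu h
    have htriv' := htriv (j + 1) hj hx hxu hyu h hd
    set q : ℝ := 1 + 70 / (K : ℝ) with hq
    have hq1 : 1 ≤ q := le_add_of_nonneg_right (by positivity)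
    set H : ℝ := β * (j + 1) * q ^ j with hHdef
    have hβp : 0 ≤ β := le_trans (by positivity) hβ0
    have hH : 0 ≤ H := by positivity
    set B : ℝ := 4 * (K * gap (j + 1) : ℕ) with hBdef
    have hB : 0 ≤ B := by positivity
    rw [walkPMF, walkPMF] at htriv' ⊢
    set T := gap j / 4 with hTdef
    set U := K * T with hUdef
    have hTg : gap j < 4 * (T + 1) := by omega
    have hgap : K * gap (j + 1) = K * gap j + U := by
      rw [hUdef, ← mul_add]; rfl
    have hU4 : 4 * U ≤ K * gap j := by
      rw [hUdef, mul_left_comm]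
      exact Nat.mul_le_mul_left _ (by omega)
    have hTU : 2 * T ≤ U := Nat.mul_le_mul_right _ hK
    have hU : 0 < U := by omega
    set a := G.edgeDist u v x with ha
    -- the expected cost given the position of the split
    set bad : ℕ → Prop := fun i =>
      a ≤ 2 * U + i + (2 * T + 4 * gap j) ∧ 2 * U + i ≤ a + (2 * T + 4 * gap j) + 1 with hbad
    set D : ℝ := B * ((2 * Real.log (G.verts.card + 1) + 3) / T) with hD
    have hD0 : 0 ≤ D := by positivity
    have main : ∀ i < U, TransportLE walkCost
        ((uniformOn (Finset.range T)).bind fun i' =>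
          if G.graph.dist x y ≤ 2 * U + i then G.walkPMF K j x y
          else
            (uniformOn (G.ellipse x y (2 * U + i + (T + 1 + i'))
              (G.graph.dist x y - (2 * U + i) + (T + 1 + i')))).bind fun z =>
            (G.walkPMF K j x z).bind fun P => (G.walkPMF K j z y).map fun Q => P ++ Q.tail)
        ((uniformOn (Finset.range T)).bind fun i' =>
          if (G.contract u v w).graph.dist x y ≤ 2 * U + i then (G.contract u v w).walkPMF K j x y
          else
            (uniformOn ((G.contract u v w).ellipse x y (2 * U + i + (T + 1 + i'))
              ((G.contract u v w).graph.dist x y - (2 * U + i) + (T + 1 + i')))).bind fun z =>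
            ((G.contract u v w).walkPMF K j x z).bind fun P =>
              ((G.contract u v w).walkPMF K j z y).map fun Q => P ++ Q.tail)
        (ENNReal.ofReal (H + (if bad i then H else 0) +
          (if i = G.graph.dist x y - 1 - 2 * U then B else 0) + D)) := by
      intro i hi
      have hn1 : (0 : ℝ) ≤ if bad i then H else 0 := by split_ifs <;> linarith
      have hn2 : (0 : ℝ) ≤ if i = G.graph.dist x y - 1 - 2 * U then B else 0 := by
        split_ifs <;> linarith
      have hir : i ∈ (uniformOn (Finset.range U)).support := by
        rwa [mem_support_uniformOn (Finset.nonempty_range_iff.2 hU.ne'), Finset.mem_range]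
      by_cases hd1 : G.graph.dist x y ≤ 2 * U + i
      · have hd2 := hL.trans hd1
        simp only [if_pos hd1, if_pos hd2, PMF.bind_const]
        refine (ih hx hxu hyu h (by omega)).mono (ENNReal.ofReal_le_ofReal ?_)
        linarith
      -- The segment is split in `G` but not in the contraction. The distances differ by at most
      -- one, so this happens for a single `i`, and the trivial cost `B` is affordable.
      by_cases hd2 : (G.contract u v w).graph.dist x y ≤ 2 * U + i
      · rw [if_pos (show i = G.graph.dist x y - 1 - 2 * U by omega)]
        refine (TransportLE.of_forall_le (B := ENNReal.ofReal B) fun l hl l' hl' => ?_).mono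
          (ENNReal.ofReal_le_ofReal (by linarith))
        exact htriv' l ((PMF.mem_support_bind_iff _ _ _).2 ⟨i, hir, hl⟩)
          l' ((PMF.mem_support_bind_iff _ _ _).2 ⟨i, hir, hl'⟩)
      · simp only [if_neg hd1, if_neg hd2]
        set ψ : ℕ → ℝ := fun i' =>
          Real.log ((G.ellipse x y (2 * U + i + (T + 1 + i' + 1))
            (G.graph.dist x y - (2 * U + i) + (T + 1 + i' + 1))).card + 1)
          - Real.log ((G.ellipse x y (2 * U + i + (T + 1 + i' - 1))
            (G.graph.dist x y - (2 * U + i) + (T + 1 + i' - 1))).card + 1) + 3 / T with hψ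
        have hψ0 : ∀ i', 0 ≤ ψ i' := by
          intro i'
          have : Real.log ((G.ellipse x y (2 * U + i + (T + 1 + i' - 1))
            (G.graph.dist x y - (2 * U + i) + (T + 1 + i' - 1))).card + 1) ≤
            Real.log ((G.ellipse x y (2 * U + i + (T + 1 + i' + 1))
            (G.graph.dist x y - (2 * U + i) + (T + 1 + i' + 1))).card + 1) := by
            refine Real.log_le_log (by positivity) ?_
            gcongr
            exact ellipse_mono (by omega) (by omega)
          have : (0 : ℝ) ≤ 3 / T := by positivity
          simp only [hψ]
          linarith
        refine (TransportLE.uniformOn_range_bind hT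
          (c := fun i' => (H + if bad i then H else 0) + ψ i' * B) ?_ ?_).mono ?_
        · intro i' _
          have := mul_nonneg (hψ0 i') hB
          linarith
        · intro i' hi'
          have hi'r : i' ∈ (uniformOn (Finset.range T)).support := by
            rwa [mem_support_uniformOn (Finset.nonempty_range_iff.2 hT.ne'), Finset.mem_range]
          have hne := ellipse_nonempty (τ := T + 1 + i') hx h (not_le.1 hd1).le
          have hne' := ellipse_nonempty (τ := T + 1 + i') hxV h' (not_le.1 hd2).le
          refine TransportLE.uniformOn_bind hne hne' (by linarith) hB
            (one_sub_card_inter_div_le hw huv hx hxu hyu h (not_le.1 hd2) hT (by omega)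
              (by omega)) ?_ ?_
          · intro z hz
            rw [Finset.mem_inter] at hz
            have hzV := ellipse_subset_verts _ _ _ _ hz.2
            obtain ⟨⟨h1, h2⟩, h3, h4⟩ := (mem_ellipse hx).1 hz.1
            have hzG := mem_verts_of_reachable hx h1
            have hzu : z ≠ u ∧ z ≠ v := by
              rcases mem_contract_verts.1 hzV with rfl | h
              · exact absurd hzG hw
              · exact h.2
            -- Both parts fit level `j`: `R + τ ≤ 3U + 2T ≤ 4U ≤ K * gap j`, and `d - R + τ ≤ (K *
            -- gap j + U) - 2U + 2T ≤ K * gap j`.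
            refine transport_walkPMF_of_split hK0 hH hw huv hx hxu hyu hzu h1 h3
              (ih hx hxu hzu h1 (by omega)) (ih hzG hzu hyu h3 (by omega)) _ ?_
            intro f1 f2
            obtain ⟨e1, e2⟩ := near_of_not_far huv h3 h2 h4 f1 f2
            simp only [hbad]
            omega
          · intro z hz z' hz'
            refine TransportLE.of_forall_le fun l hl l' hl' => ?_
            refine htriv' l ((PMF.mem_support_bind_iff _ _ _).2 ⟨i, hir,
              (PMF.mem_support_bind_iff _ _ _).2 ⟨i', hi'r, ?_⟩⟩)
              l' ((PMF.mem_support_bind_iff _ _ _).2 ⟨i, hir,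
              (PMF.mem_support_bind_iff _ _ _).2 ⟨i', hi'r, ?_⟩⟩)
            · rw [if_neg hd1]
              exact (PMF.mem_support_bind_iff _ _ _).2
                ⟨z, (mem_support_uniformOn hne).2 hz, hl⟩
            · rw [if_neg hd2]
              exact (PMF.mem_support_bind_iff _ _ _).2
                ⟨z', (mem_support_uniformOn hne').2 hz', hl'⟩
        · refine ENNReal.ofReal_le_ofReal ?_
          have hTr : (0 : ℝ) < T := by exact_mod_cast hT
          have hs := sum_log_card_ellipse_le (G := G) x y (2 * U + i)
            (G.graph.dist x y - (2 * U + i)) T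
          have hψs : ∑ i' ∈ Finset.range T, ψ i' ≤ 2 * Real.log (G.verts.card + 1) + 3 := by
            simp only [hψ]
            rw [Finset.sum_add_distrib, Finset.sum_const, Finset.card_range, nsmul_eq_mul,
              mul_div_cancel₀ _ hTr.ne']
            linarith
          rw [Finset.sum_add_distrib, Finset.sum_const, Finset.card_range, nsmul_eq_mul, add_div,
            mul_div_cancel_left₀ _ hTr.ne', ← Finset.sum_mul, mul_comm _ B, mul_div_assoc]
          have : B * ((∑ i' ∈ Finset.range T, ψ i') / T) ≤ D := by
            rw [hD]; gcongr
          linarith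
    refine (TransportLE.uniformOn_range_bind hU ?_ main).mono (ENNReal.ofReal_le_ofReal ?_)
    · intro i _
      have hn1 : (0 : ℝ) ≤ if bad i then H else 0 := by split_ifs <;> linarith
      have hn2 : (0 : ℝ) ≤ if i = G.graph.dist x y - 1 - 2 * U then B else 0 := by
        split_ifs <;> linarith
      linarith
    · have hUr : (0 : ℝ) < U := by exact_mod_cast hU
      have hTr : (0 : ℝ) < T := by exact_mod_cast hT
      have hK0r : (0 : ℝ) < K := by exact_mod_cast hK0
      have b1 : ∑ i ∈ Finset.range U, (if bad i then H else 0) ≤ 70 * T * H := by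
        rw [← Finset.sum_filter, Finset.sum_const, nsmul_eq_mul]
        gcongr
        have := card_filter_near_le U (2 * T + 4 * gap j) (2 * U) a
        -- Here `gap j ≤ 4T + 3` and `T ≥ 1`, so `2 * (2T + 4 * gap j) + 2 ≤ 62T`.
        have h70 : ((Finset.range U).filter bad).card ≤ 70 * T := this.trans (by omega)
        exact_mod_cast h70
      have b2 : ∑ i ∈ Finset.range U, (if i = G.graph.dist x y - 1 - 2 * U then B else 0) ≤ B := by
        rw [Finset.sum_ite_eq']
        split_ifs <;> linarith
      have hUK : (U : ℝ) = K * T := by rw [hUdef]; push_cast; ring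
      have b3 : B ≤ 36 * U := by
        have : K * gap (j + 1) ≤ 9 * U := by
          have : K * gap j ≤ K * (8 * T) := Nat.mul_le_mul_left _ (by omega)
          rw [mul_left_comm] at this
          omega
        have : ((K * gap (j + 1) : ℕ) : ℝ) ≤ 9 * U := by exact_mod_cast this
        rw [hBdef]
        linarith
      have b4 : D ≤ 36 * K * (2 * Real.log (G.verts.card + 1) + 3) := by
        rw [hD, mul_div_assoc', div_le_iff₀ hTr]
        calc B * (2 * Real.log (G.verts.card + 1) + 3)
            ≤ 36 * U * (2 * Real.log (G.verts.card + 1) + 3) := by gcongr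
          _ = _ := by rw [hUK]; ring
      rw [div_le_iff₀ hUr, Finset.sum_add_distrib, Finset.sum_add_distrib, Finset.sum_add_distrib,
        Finset.sum_const, Finset.sum_const, Finset.card_range, nsmul_eq_mul, nsmul_eq_mul]
      have b5 : U * H + 70 * T * H = U * (H * q) := by
        rw [hq, hUK]
        field_simp
      -- Averaged over `i`, the exceptional position contributes `B / U ≤ 36`, the first summand of
      -- `β`; the second one bounds `D`.
      have b6 : (U : ℝ) * D + 36 * U ≤ U * β := by
        rw [mul_comm 36, ← mul_add]
        gcongr
        linarith
      have b7 : H * q + β ≤ β * ((j + 1 : ℕ) + 1) * q ^ (j + 1) := by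
        have : β * 1 ≤ β * q ^ (j + 1) := by
          gcongr
          exact one_le_pow₀ hq1
        rw [hHdef, pow_succ] at *
        push_cast
        linarith
      have b8 : (U : ℝ) * (H * q + β) ≤ U * (β * ((j + 1 : ℕ) + 1) * q ^ (j + 1)) := by gcongr
      linarith

end FinGraph

/-! ### The algorithm on adjacency lists -/

namespace AdjList

/-- The vertices within distance `r` of `x`. -/
def ball (c : List (ℕ × List ℕ)) (x r : ℕ) : List ℕ :=
  (fun l => (c.map Prod.fst).filter fun z => z ∈ l ∨ ∃ p ∈ c, p.1 ∈ l ∧ z ∈ p.2)^[r] [x]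

/-- The distance of two vertices in the same component. -/
def dist (c : List (ℕ × List ℕ)) (x y : ℕ) : ℕ :=
  ((List.range c.length).filter fun r => y ∉ ball c x r).length

/-- The vertices at distance at most `a` from `x` and at most `b` from `y`. -/
def ellipse (c : List (ℕ × List ℕ)) (x y a b : ℕ) : List ℕ :=
  (c.map Prod.fst).filter fun z => z ∈ ball c x a ∧ y ∈ ball c z b

/-- The first vertex after `x` on the canonical shortest path from `x` to `y`. -/
def hop (c : List (ℕ × List ℕ)) (y x : ℕ) : ℕ := (ellipse c x y 1 (dist c x y - 1)).headI

/-- The canonical shortest path from `x` to `y`, without its first vertex. -/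
def geodesicTail (c : List (ℕ × List ℕ)) (x y : ℕ) : List ℕ :=
  (List.range (dist c x y)).map fun i => (hop c y)^[i + 1] x

/-- The number of seeds needed for `j` levels of the recursion; `F` is a common multiple of the
sizes of all sets of vertices. -/
def seedCount (K F : ℕ) : ℕ → ℕ
  | 0 => 1
  | j + 1 => K * (gap j / 4) * (gap j / 4 * (F * (seedCount K F j * seedCount K F j)))

/-- Splitting a segment according to a seed. A segment is given by its end points and a seed for
its subsequent treatment. -/
def split (c : List (ℕ × List ℕ)) (K j : ℕ) (p : ℕ × ℕ × ℕ) : List (ℕ × ℕ × ℕ) :=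
  let T := gap j / 4
  let U := K * T
  let F := c.length.factorial
  let A := seedCount K F j
  let R := 2 * U + p.2.2 % U
  let τ := T + 1 + p.2.2 / U % T
  let q := p.2.2 / U / T % F
  let r := p.2.2 / U / T / F
  let E := ellipse c p.1 p.2.1 (R + τ) (dist c p.1 p.2.1 - R + τ)
  if dist c p.1 p.2.1 ≤ R then [(p.1, p.2.1, r % A)]
  else [(p.1, E.getI (q % E.length), r % A), (E.getI (q % E.length), p.2.1, r / A)]

/-- The walk obtained from a segment by `j` levels of splitting, without its first vertex. -/
def expand (c : List (ℕ × List ℕ)) (K : ℕ) : ℕ → ℕ × ℕ × ℕ → List ℕ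
  | 0, p => geodesicTail c p.1 p.2.1
  | j + 1, p => (split c K j p).flatMap (expand c K j)

/-- The segments after the first `i` of `J` levels of splitting. -/
def segments (c : List (ℕ × List ℕ)) (K J : ℕ) (p : ℕ × ℕ × ℕ) (i : ℕ) : List (ℕ × ℕ × ℕ) :=
  Nat.rec [p] (fun i l => l.flatMap (split c K (J - 1 - i))) i

/-- Processing a flat list level by level agrees with the branching recursion `expand`, by
associativity of `flatMap`. The iterated form is the one whose computability is direct. -/
theorem flatMap_segments (c : List (ℕ × List ℕ)) (K J : ℕ) (p : ℕ × ℕ × ℕ) {i : ℕ} (hi : i ≤ J) :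
    (segments c K J p i).flatMap (expand c K (J - i)) = expand c K J p := by
  induction i with
  | zero => simp [segments]
  | succ i ih =>
    rw [← ih (by omega)]
    have e : J - i = (J - 1 - i) + 1 := by omega
    have e' : J - (i + 1) = J - 1 - i := by omega
    rw [e, e']
    change ((segments c K J p i).flatMap (split c K (J - 1 - i))).flatMap _ = _
    rw [List.flatMap_assoc]
    rfl

end AdjList

/-! ### Agreement of the list procedures with the graph definitions -/

namespace FinGraph

variable {G : FinGraph}

theorem map_fst_code : G.code.map Prod.fst = G.verts.sort (· ≤ ·) := by
  simp [code, List.map_map, Function.comp_def]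

theorem length_code : G.code.length = G.verts.card := by
  simp [code]

theorem exists_mem_code_iff {l : List ℕ} {z : ℕ} :
    (∃ p ∈ G.code, p.1 ∈ l ∧ z ∈ p.2) ↔ ∃ y ∈ l, G.graph.Adj y z := by
  simp only [code, List.mem_map, Finset.mem_sort]
  constructor
  · rintro ⟨p, ⟨y, hy, rfl⟩, h1, h2⟩
    simp only [Finset.mem_sort, Finset.mem_filter] at h2
    exact ⟨y, h1, h2.2⟩
  · rintro ⟨y, hy, h⟩
    refine ⟨_, ⟨y, G.mem_verts_of_adj h, rfl⟩, hy, ?_⟩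
    simp only [Finset.mem_sort, Finset.mem_filter]
    exact ⟨G.mem_verts_of_adj h.symm, h⟩

theorem mem_ball_code {x r z : ℕ} (hx : x ∈ G.verts) :
    z ∈ AdjList.ball G.code x r ↔ G.graph.Reachable x z ∧ G.graph.dist x z ≤ r := by
  induction r generalizing z with
  | zero =>
    simp only [AdjList.ball, Function.iterate_zero, id, List.mem_singleton, Nat.le_zero]
    constructor
    · rintro rfl
      exact ⟨.refl _, G.graph.dist_self⟩
    · rintro ⟨h1, h2⟩
      exact (h1.dist_eq_zero_iff.1 h2).symm
  | succ r ih =>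
    rw [AdjList.ball, Function.iterate_succ_apply', ← AdjList.ball, List.mem_filter, map_fst_code,
      Finset.mem_sort, decide_eq_true_iff, exists_mem_code_iff, ih]
    constructor
    · rintro ⟨-, ⟨h1, h2⟩ | ⟨y, hy, h⟩⟩
      · exact ⟨h1, by omega⟩
      · obtain ⟨h1, h2⟩ := ih.1 hy
        have := h1.dist_triangle_left z
        have := SimpleGraph.dist_eq_one_iff_adj.2 h
        exact ⟨h1.trans h.reachable, by omega⟩
    · rintro ⟨h1, h2⟩
      refine ⟨mem_verts_of_reachable hx h1, ?_⟩
      by_cases h3 : G.graph.dist x z ≤ r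
      · exact Or.inl ⟨h1, h3⟩
      · obtain ⟨y, e1, e2, e3, e4⟩ := exists_dist_eq (i := r) h1 (by omega)
        exact Or.inr ⟨y, ih.2 ⟨e1, e2.le⟩, SimpleGraph.dist_eq_one_iff_adj.1 (by omega)⟩

theorem dist_lt_card {x y : ℕ} (hx : x ∈ G.verts) (h : G.graph.Reachable x y) :
    G.graph.dist x y < G.verts.card :=
  (lt_card_ellipse hx h le_rfl le_rfl).trans_le
    (Finset.card_le_card (ellipse_subset_verts _ _ _ _))

/-- The radii below `n` whose ball misses `y` are exactly those below the distance, since the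
distance is less than `n`. -/
theorem dist_code {x y : ℕ} (hx : x ∈ G.verts) (h : G.graph.Reachable x y) :
    AdjList.dist G.code x y = G.graph.dist x y := by
  have hd := dist_lt_card hx h
  have e : ((List.range G.verts.card).filter fun r => decide (y ∉ AdjList.ball G.code x r)) =
      (List.range G.verts.card).filter fun r => decide (r < G.graph.dist x y) := by
    refine List.filter_congr fun r _ => ?_
    rw [decide_eq_decide, mem_ball_code hx]
    simp [h]
  rw [AdjList.dist, length_code, e]
  have := List.toFinset_card_of_nodup (List.nodup_range (n := G.verts.card) |>.filter
    fun r => decide (r < G.graph.dist x y))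
  rw [← this, ← Finset.card_range (G.graph.dist x y)]
  congr 1
  ext r
  simp
  omega

/-- Filtering the sorted vertex list keeps it sorted and without repetitions. Equality as lists is
needed because `hop` takes the head and seeds select by index. -/
theorem ellipse_code {x y a b : ℕ} (hx : x ∈ G.verts) :
    AdjList.ellipse G.code x y a b = (G.ellipse x y a b).sort (· ≤ ·) := by
  have hnd : (AdjList.ellipse G.code x y a b).Nodup := by
    rw [AdjList.ellipse, map_fst_code]
    exact (Finset.sort_nodup _ _).filter _
  have hpw : (AdjList.ellipse G.code x y a b).Pairwise (· ≤ ·) := by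
    rw [AdjList.ellipse, map_fst_code]
    exact (Finset.pairwise_sort _ _).filter _
  rw [← (List.toFinset_sort (· ≤ ·) hnd).2 hpw]
  congr 1
  ext z
  rw [List.mem_toFinset, AdjList.ellipse, List.mem_filter, map_fst_code, Finset.mem_sort,
    decide_eq_true_iff, mem_ellipse hx, mem_ball_code hx]
  constructor
  · rintro ⟨hz, h1, h2⟩
    exact ⟨h1, (mem_ball_code hz).1 h2⟩
  · rintro ⟨h1, h2⟩
    have hz := mem_verts_of_reachable hx h1.1
    exact ⟨hz, h1, (mem_ball_code hz).2 h2⟩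

theorem hop_code {x y : ℕ} (hx : x ∈ G.verts) (h : G.graph.Reachable x y) :
    AdjList.hop G.code y x = G.hop y x := by
  rw [AdjList.hop, hop, ellipse_code hx, dist_code hx h]

theorem geodesic_code {x y : ℕ} (hx : x ∈ G.verts) (h : G.graph.Reachable x y) :
    x :: AdjList.geodesicTail G.code x y = G.geodesic x y := by
  have key : ∀ i x, x ∈ G.verts → G.graph.Reachable x y → i ≤ G.graph.dist x y →
      (AdjList.hop G.code y)^[i] x = (G.hop y)^[i] x := by
    intro i
    induction i with
    | zero => intros; rfl
    | succ i ih =>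
      intro x hx h hi
      obtain ⟨h1, h2⟩ := hop_spec hx h (by omega)
      rw [Function.iterate_succ_apply, Function.iterate_succ_apply, hop_code hx h]
      exact ih _ (G.mem_verts_of_adj h1.symm) (h1.symm.reachable.trans h) (by omega)
  rw [geodesic, List.range_succ_eq_map, List.map_cons, List.map_map, AdjList.geodesicTail,
    dist_code hx h, Function.iterate_zero, id]
  congr 1
  refine List.map_congr_left fun i hi => ?_
  rw [List.mem_range] at hi
  exact key _ x hx h hi

end FinGraph

/-! ### Sampling with seeds -/

/-- The low digit and the quotient of a uniform number below `a * b` are independent and uniform. -/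
theorem uniformOn_range_mul_bind {β : Type*} {a b : ℕ} (ha : 0 < a) (hb : 0 < b)
    (f : ℕ → ℕ → PMF β) :
    (uniformOn (Finset.range (a * b))).bind (fun r => f (r % a) (r / a)) =
      (uniformOn (Finset.range a)).bind fun i => (uniformOn (Finset.range b)).bind (f i) := by
  have hne : ∀ {n : ℕ}, 0 < n → (Finset.range n).Nonempty :=
    fun h => Finset.nonempty_range_iff.2 h.ne'
  have hsum : ∀ {n : ℕ} (hn : 0 < n) (g : ℕ → ℝ≥0∞),
      ∑' i, uniformOn (Finset.range n) i * g i = ∑ i ∈ Finset.range n, (n : ℝ≥0∞)⁻¹ * g i := by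
    intro n hn g
    rw [uniformOn_of_nonempty (hne hn), tsum_eq_sum (s := Finset.range n)]
    · refine Finset.sum_congr rfl fun i hi => ?_
      rw [PMF.uniformOfFinset_apply_of_mem _ hi, Finset.card_range]
    · intro i hi
      rw [PMF.uniformOfFinset_apply_of_notMem _ hi, zero_mul]
  ext y
  simp only [PMF.bind_apply]
  rw [hsum (Nat.mul_pos ha hb), hsum ha]
  simp only [hsum hb, Finset.mul_sum]
  rw [← Finset.sum_product']
  refine Finset.sum_nbij' (fun r => (r % a, r / a)) (fun p => p.1 + a * p.2) ?_ ?_ ?_ ?_ ?_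
  · intro r hr
    rw [Finset.mem_range] at hr
    rw [Finset.mem_product, Finset.mem_range, Finset.mem_range]
    exact ⟨Nat.mod_lt _ ha, (Nat.div_lt_iff_lt_mul ha).2 (by rwa [mul_comm])⟩
  · rintro ⟨i, q⟩ hp
    simp only [Finset.mem_product, Finset.mem_range] at hp ⊢
    calc i + a * q < a + a * q := by omega
      _ = a * (q + 1) := by ring
      _ ≤ a * b := Nat.mul_le_mul_left _ hp.2
  · intro r _
    exact Nat.mod_add_div r a
  · rintro ⟨i, q⟩ hp
    simp only [Finset.mem_product, Finset.mem_range] at hp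
    simp [Nat.add_mul_mod_self_left, Nat.mod_eq_of_lt hp.1, Nat.add_mul_div_left _ _ ha,
      Nat.div_eq_of_lt hp.1]
  · intro r _
    rw [← mul_assoc, Nat.cast_mul, ENNReal.mul_inv]
    · exact Or.inr (ENNReal.natCast_ne_top b)
    · exact Or.inl (ENNReal.natCast_ne_top a)

theorem uniformOn_range_bind_mod {β : Type*} {a N : ℕ} (hN : 0 < N) (h : a ∣ N)
    (f : ℕ → PMF β) :
    (uniformOn (Finset.range N)).bind (fun r => f (r % a)) =
      (uniformOn (Finset.range a)).bind f := by
  obtain ⟨b, rfl⟩ := h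
  rw [uniformOn_range_mul_bind (Nat.pos_of_mul_pos_right hN) (Nat.pos_of_mul_pos_left hN)
    (fun i _ => f i)]
  simp only [PMF.bind_const]

theorem uniformOn_map {S : Finset ℕ} (hS : S.Nonempty) {g : ℕ → ℕ} (hg : Set.InjOn g S) :
    (uniformOn S).map g = uniformOn (S.image g) := by
  ext y
  rw [uniformOn_of_nonempty hS, uniformOn_of_nonempty (hS.image g), PMF.map_apply]
  by_cases hy : y ∈ S.image g
  · rw [PMF.uniformOfFinset_apply_of_mem _ hy, Finset.card_image_of_injOn hg]
    obtain ⟨a, ha, rfl⟩ := Finset.mem_image.1 hy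
    rw [tsum_eq_single a, if_pos rfl, PMF.uniformOfFinset_apply_of_mem _ ha]
    intro b hb
    by_cases hbS : b ∈ S
    · exact if_neg fun h => hb (hg hbS ha h.symm)
    · rw [PMF.uniformOfFinset_apply_of_notMem _ hbS, ite_self]
  · rw [PMF.uniformOfFinset_apply_of_notMem _ hy, ENNReal.tsum_eq_zero]
    intro a
    by_cases ha : a ∈ S
    · refine if_neg ?_
      rintro rfl
      exact hy (Finset.mem_image_of_mem g ha)
    · rw [PMF.uniformOfFinset_apply_of_notMem _ ha, ite_self]

/-- As `S.card` divides `N`, the residue is exactly uniform on the indices. The factorial in the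
seed count provides this divisibility for all candidate sets at once. -/
theorem uniformOn_range_bind_getI {β : Type*} {S : Finset ℕ} (hS : S.Nonempty) {N : ℕ}
    (hN : 0 < N) (hSN : S.card ∣ N) (f : ℕ → PMF β) :
    (uniformOn (Finset.range N)).bind
        (fun q => f ((S.sort (· ≤ ·)).getI (q % (S.sort (· ≤ ·)).length))) =
      (uniformOn S).bind f := by
  set l := S.sort (· ≤ ·) with hl
  have hlen : l.length = S.card := Finset.length_sort _
  have hget : ∀ i (hi : i < l.length), l.getI i = l[i] := fun i hi => List.getI_eq_getElem l hi
  rw [uniformOn_range_bind_mod hN (hlen ▸ hSN) (fun i => f (l.getI i))]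
  have hinj : Set.InjOn l.getI (Finset.range l.length) := by
    intro i hi k hk hik
    rw [Finset.mem_coe, Finset.mem_range] at hi hk
    rw [hget i hi, hget k hk] at hik
    exact (List.Nodup.getElem_inj_iff (Finset.sort_nodup _ _)).1 hik
  have himg : (Finset.range l.length).image l.getI = S := by
    ext z
    rw [Finset.mem_image, ← Finset.mem_sort (· ≤ ·), ← hl, List.mem_iff_getElem]
    constructor
    · rintro ⟨i, hi, rfl⟩
      rw [Finset.mem_range] at hi
      exact ⟨i, hi, (hget i hi).symm⟩
    · rintro ⟨i, hi, rfl⟩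
      exact ⟨i, Finset.mem_range.2 hi, hget i hi⟩
  have := uniformOn_map (S := Finset.range l.length)
    (Finset.nonempty_range_iff.2 (by rw [hlen]; exact hS.card_pos.ne')) hinj
  rw [himg] at this
  rw [← this, PMF.bind_map]
  rfl

namespace FinGraph

variable {G : FinGraph}

theorem seedCount_pos {K F : ℕ} (hK : 0 < K) (hF : 0 < F) (j : ℕ) :
    0 < AdjList.seedCount K F j := by
  induction j with
  | zero => exact Nat.one_pos
  | succ j ih =>
    have := gap_div_pos j
    rw [AdjList.seedCount]
    positivity

/-- The algorithm on adjacency lists samples from `walkPMF`. -/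
theorem map_expand_code {K : ℕ} (hK : 0 < K) (j : ℕ) :
    ∀ {x y : ℕ}, x ∈ G.verts → G.graph.Reachable x y →
      (uniformOn (Finset.range (AdjList.seedCount K G.code.length.factorial j))).map
        (fun r => x :: AdjList.expand G.code K j (x, y, r)) = G.walkPMF K j x y := by
  induction j with
  | zero =>
    intro x y hx h
    simp only [AdjList.expand, walkPMF, geodesic_code hx h]
    exact PMF.map_const _ _
  | succ j ih =>
    intro x y hx h
    have hT := gap_div_pos j
    have hU : 0 < K * (gap j / 4) := Nat.mul_pos hK hT
    have hF : 0 < G.code.length.factorial := Nat.factorial_pos _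
    have hA := seedCount_pos hK hF j
    set F := G.code.length.factorial with hFdef
    set A := AdjList.seedCount K F j with hAdef
    rw [walkPMF, AdjList.seedCount, ← hAdef]
    -- the outcome as a function of the digits of the seed
    let out : ℕ → ℕ → ℕ → ℕ → ℕ → List ℕ := fun i i' q ra rb =>
      x :: (if AdjList.dist G.code x y ≤ 2 * (K * (gap j / 4)) + i then
        [(x, y, ra)] else
        let E := AdjList.ellipse G.code x y (2 * (K * (gap j / 4)) + i + (gap j / 4 + 1 + i'))
          (AdjList.dist G.code x y - (2 * (K * (gap j / 4)) + i) + (gap j / 4 + 1 + i'))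
        [(x, E.getI (q % E.length), ra), (E.getI (q % E.length), y, rb)]).flatMap
          (AdjList.expand G.code K j)
    have hout : (fun r => x :: AdjList.expand G.code K (j + 1) (x, y, r)) = fun r =>
        out (r % (K * (gap j / 4))) (r / (K * (gap j / 4)) % (gap j / 4))
          (r / (K * (gap j / 4)) / (gap j / 4) % F)
          (r / (K * (gap j / 4)) / (gap j / 4) / F % A)
          (r / (K * (gap j / 4)) / (gap j / 4) / F / A) := rfl
    rw [hout, ← PMF.bind_pure_comp]
    refine (uniformOn_range_mul_bind hU (by positivity) (fun i r => PMF.pure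
      (out i (r % (gap j / 4)) (r / (gap j / 4) % F) (r / (gap j / 4) / F % A)
        (r / (gap j / 4) / F / A)))).trans ?_
    refine congrArg _ (funext fun i => ?_)
    refine (uniformOn_range_mul_bind hT (by positivity) (fun i' r => PMF.pure
      (out i i' (r % F) (r / F % A) (r / F / A)))).trans ?_
    refine congrArg _ (funext fun i' => ?_)
    refine (uniformOn_range_mul_bind hF (by positivity) (fun q r => PMF.pure
      (out i i' q (r % A) (r / A)))).trans ?_
    have e : ∀ q, (uniformOn (Finset.range (A * A))).bind
        (fun r => PMF.pure (out i i' q (r % A) (r / A))) =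
        (uniformOn (Finset.range A)).bind fun ra => (uniformOn (Finset.range A)).bind fun rb =>
          PMF.pure (out i i' q ra rb) :=
      fun q => uniformOn_range_mul_bind hA hA (fun ra rb => PMF.pure (out i i' q ra rb))
    simp only [e]
    by_cases hd : G.graph.dist x y ≤ 2 * (K * (gap j / 4)) + i
    · simp only [out, dist_code hx h, if_pos hd, List.flatMap_singleton, PMF.bind_const]
      rw [← ih hx h]
      exact PMF.bind_pure_comp _ _
    · simp only [out, dist_code hx h, if_neg hd, ellipse_code hx]
      have hne := ellipse_nonempty (τ := gap j / 4 + 1 + i') hx h (not_le.1 hd).le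
      have hcard : (G.ellipse x y (2 * (K * (gap j / 4)) + i + (gap j / 4 + 1 + i'))
          (G.graph.dist x y - (2 * (K * (gap j / 4)) + i) + (gap j / 4 + 1 + i'))).card ∣ F := by
        refine Nat.dvd_factorial hne.card_pos ?_
        rw [length_code]
        exact Finset.card_le_card (ellipse_subset_verts _ _ _ _)
      refine (uniformOn_range_bind_getI hne hF hcard (fun z =>
        (uniformOn (Finset.range A)).bind fun ra => (uniformOn (Finset.range A)).bind fun rb =>
          PMF.pure (x :: List.flatMap (AdjList.expand G.code K j) [(x, z, ra), (z, y, rb)]))).trans ?_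
      refine PMF.bind_congr_support _ fun z hz => ?_
      rw [mem_support_uniformOn hne, mem_ellipse hx] at hz
      rw [← ih hx hz.1.1, ← ih (mem_verts_of_reachable hx hz.1.1) hz.2.1, PMF.bind_map]
      refine congrArg _ (funext fun ra => ?_)
      simp only [Function.comp_apply, PMF.map_comp]
      rw [← PMF.bind_pure_comp]
      refine congrArg _ (funext fun rb => ?_)
      simp [List.flatMap_cons]

end FinGraph

/-! ### Computability -/

namespace AdjList

open Primrec

variable {α β : Type*} [Primcodable α] [Primcodable β]

theorem _root_.PrimrecPred.list_filter {f : α → List β} {p : α → β → Prop}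
    [∀ a, DecidablePred (p a)] (hf : Primrec f) (hp : PrimrecPred fun z : α × β => p z.1 z.2) :
    Primrec fun a => (f a).filter fun b => decide (p a b) := by
  let _ : DecidableRel fun (b : β) (a : α) => p a b := fun b a => inferInstanceAs (Decidable (p a b))
  have hR : PrimrecRel fun (b : β) (a : α) => p a b := hp.comp (Primrec.pair snd fst)
  exact hR.listFilter.comp hf .id

theorem _root_.PrimrecPred.exists_mem {f : α → List β} {p : α → β → Prop}
    (hf : Primrec f) (hp : PrimrecPred fun z : α × β => p z.1 z.2) :
    PrimrecPred fun a => ∃ b ∈ f a, p a b := by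
  have hR : PrimrecRel fun (b : β) (a : α) => p a b := hp.comp (Primrec.pair snd fst)
  exact hR.exists_mem_list.comp hf .id

theorem _root_.PrimrecPred.mem_list {f : α → List β} {g : α → β} (hf : Primrec f)
    (hg : Primrec g) : PrimrecPred fun a => g a ∈ f a := by
  refine (PrimrecPred.exists_mem (p := fun a b => b = g a) hf ?_).of_eq fun a => by simp
  exact Primrec.eq.comp snd (hg.comp fst)

theorem primrec_ball {c : α → List (ℕ × List ℕ)} {x r : α → ℕ} (hc : Primrec c) (hx : Primrec x)
    (hr : Primrec r) : Primrec fun a => ball (c a) (x a) (r a) := by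
  refine Primrec.nat_iterate (h := fun a l => ((c a).map Prod.fst).filter fun z =>
    z ∈ l ∨ ∃ p ∈ c a, p.1 ∈ l ∧ z ∈ p.2) hr (list_cons.comp hx (const [])) ?_
  refine PrimrecPred.list_filter (f := fun q : α × List ℕ => (c q.1).map Prod.fst)
    (p := fun (q : α × List ℕ) z => z ∈ q.2 ∨ ∃ p ∈ c q.1, p.1 ∈ q.2 ∧ z ∈ p.2)
    (list_map (hc.comp fst) (fst.comp snd).to₂) ?_
  refine (PrimrecPred.mem_list (snd.comp fst) snd).or ?_
  refine PrimrecPred.exists_mem (f := fun z : (α × List ℕ) × ℕ => c z.1.1)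
    (p := fun z p => p.1 ∈ z.1.2 ∧ z.2 ∈ p.2) (hc.comp (fst.comp fst)) ?_
  exact (PrimrecPred.mem_list (snd.comp (fst.comp fst)) (fst.comp snd)).and
    (PrimrecPred.mem_list (snd.comp snd) (snd.comp fst))

theorem primrec_dist {c : α → List (ℕ × List ℕ)} {x y : α → ℕ} (hc : Primrec c) (hx : Primrec x)
    (hy : Primrec y) : Primrec fun a => dist (c a) (x a) (y a) := by
  refine list_length.comp (PrimrecPred.list_filter (p := fun a r => y a ∉ ball (c a) (x a) r)
    (list_range.comp (list_length.comp hc)) ?_)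
  exact (PrimrecPred.mem_list (primrec_ball (hc.comp fst) (hx.comp fst) snd) (hy.comp fst)).not

theorem primrec_ellipse {c : α → List (ℕ × List ℕ)} {x y a b : α → ℕ} (hc : Primrec c)
    (hx : Primrec x) (hy : Primrec y) (ha : Primrec a) (hb : Primrec b) :
    Primrec fun i => ellipse (c i) (x i) (y i) (a i) (b i) := by
  refine PrimrecPred.list_filter (f := fun i => (c i).map Prod.fst)
    (p := fun i z => z ∈ ball (c i) (x i) (a i) ∧ y i ∈ ball (c i) z (b i))
    (list_map hc (fst.comp snd).to₂) ?_
  exact (PrimrecPred.mem_list (primrec_ball (hc.comp fst) (hx.comp fst) (ha.comp fst)) snd).and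
    (PrimrecPred.mem_list (primrec_ball (hc.comp fst) snd (hb.comp fst)) (hy.comp fst))

theorem primrec_hop {c : α → List (ℕ × List ℕ)} {x y : α → ℕ} (hc : Primrec c) (hx : Primrec x)
    (hy : Primrec y) : Primrec fun a => hop (c a) (y a) (x a) :=
  list_headI.comp (primrec_ellipse hc hx hy (const 1)
    (nat_sub.comp (primrec_dist hc hx hy) (const 1)))

theorem primrec_geodesicTail {c : α → List (ℕ × List ℕ)} {x y : α → ℕ} (hc : Primrec c)
    (hx : Primrec x) (hy : Primrec y) : Primrec fun a => geodesicTail (c a) (x a) (y a) := by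
  refine list_map (g := fun a i => (hop (c a) (y a))^[i + 1] (x a))
    (list_range.comp (primrec_dist hc hx hy)) ?_
  exact Primrec.nat_iterate (f := fun z : α × ℕ => z.2 + 1) (g := fun z : α × ℕ => x z.1)
    (h := fun (z : α × ℕ) i => hop (c z.1) (y z.1) i) (succ.comp snd) (hx.comp fst)
    (primrec_hop (hc.comp (fst.comp fst)) snd (hy.comp (fst.comp fst)))

theorem primrec_gap : Primrec gap := by
  refine (Primrec.nat_rec₁ (f := fun _ g => g + g / 4) 4
    (nat_add.comp snd (nat_div.comp snd (const 4)))).of_eq fun n => ?_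
  induction n with
  | zero => rfl
  | succ n ih => rw [gap, ← ih]

theorem primrec_factorial : Primrec Nat.factorial := by
  refine (Primrec.nat_rec₁ (f := fun n g => (n + 1) * g) 1
    (nat_mul.comp (succ.comp fst) snd)).of_eq fun n => ?_
  induction n with
  | zero => rfl
  | succ n ih => rw [Nat.factorial_succ, ← ih]

theorem primrec_seedCount {K F j : α → ℕ} (hK : Primrec K) (hF : Primrec F) (hj : Primrec j) :
    Primrec fun a => seedCount (K a) (F a) (j a) := by
  have hT : Primrec fun q : α × ℕ × ℕ => gap q.2.1 / 4 :=
    nat_div.comp (primrec_gap.comp (fst.comp snd)) (const 4)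
  have hA : Primrec fun q : α × ℕ × ℕ => q.2.2 := snd.comp snd
  refine (Primrec.nat_rec' (f := j) (g := fun _ => 1) (h := fun a q =>
    K a * (gap q.1 / 4) * (gap q.1 / 4 * (F a * (q.2 * q.2)))) hj (const 1)
    (nat_mul.comp (nat_mul.comp (hK.comp fst) hT)
      (nat_mul.comp hT (nat_mul.comp (hF.comp fst) (nat_mul.comp hA hA))))).of_eq fun a => ?_
  induction j a with
  | zero => rfl
  | succ n ih => rw [seedCount, ← ih]

theorem primrec_split {c : α → List (ℕ × List ℕ)} {K j : α → ℕ} {p : α → ℕ × ℕ × ℕ}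
    (hc : Primrec c) (hK : Primrec K) (hj : Primrec j) (hp : Primrec p) :
    Primrec fun a => split (c a) (K a) (j a) (p a) := by
  have hx := fst.comp hp
  have hy := fst.comp (snd.comp hp)
  have hr := snd.comp (snd.comp hp)
  have hT : Primrec fun a => gap (j a) / 4 := nat_div.comp (primrec_gap.comp hj) (const 4)
  have hU : Primrec fun a => K a * (gap (j a) / 4) := nat_mul.comp hK hT
  have hF : Primrec fun a => (c a).length.factorial := primrec_factorial.comp (list_length.comp hc)
  have hA := primrec_seedCount hK hF hj
  have hR := nat_add.comp (nat_mul.comp (const 2) hU) (nat_mod.comp hr hU)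
  have hr1 := nat_div.comp hr hU
  have hτ := nat_add.comp (nat_add.comp hT (const 1)) (nat_mod.comp hr1 hT)
  have hr2 := nat_div.comp hr1 hT
  have hq := nat_mod.comp hr2 hF
  have hr3 := nat_div.comp hr2 hF
  have hd := primrec_dist hc hx hy
  have hE := primrec_ellipse hc hx hy (nat_add.comp hR hτ) (nat_add.comp (nat_sub.comp hd hR) hτ)
  have hz := list_getI.comp hE (nat_mod.comp hq (list_length.comp hE))
  have h1 := nat_mod.comp hr3 hA
  have h2 := nat_div.comp hr3 hA
  exact Primrec.ite (nat_le.comp hd hR)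
    (list_cons.comp (hx.pair (hy.pair h1)) (const []))
    (list_cons.comp (hx.pair (hz.pair h1)) (list_cons.comp (hz.pair (hy.pair h2)) (const [])))

theorem primrec_segments {c : α → List (ℕ × List ℕ)} {K J i : α → ℕ} {p : α → ℕ × ℕ × ℕ}
    (hc : Primrec c) (hK : Primrec K) (hJ : Primrec J) (hp : Primrec p) (hi : Primrec i) :
    Primrec fun a => segments (c a) (K a) (J a) (p a) (i a) := by
  refine Primrec.nat_rec' (f := i) (g := fun a => [p a]) (h := fun a (q : ℕ × List (ℕ × ℕ × ℕ)) =>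
    q.2.flatMap (split (c a) (K a) (J a - 1 - q.1))) hi (list_cons.comp hp (const [])) ?_
  refine list_flatMap (f := fun z : α × ℕ × List (ℕ × ℕ × ℕ) => z.2.2)
    (g := fun z => split (c z.1) (K z.1) (J z.1 - 1 - z.2.1)) (snd.comp snd) ?_
  exact primrec_split (hc.comp (fst.comp fst)) (hK.comp (fst.comp fst))
    (nat_sub.comp (nat_sub.comp (hJ.comp (fst.comp fst)) (const 1)) (fst.comp (snd.comp fst))) snd

theorem primrec_two_pow : Primrec fun n : ℕ => 2 ^ n := by
  refine (Primrec.nat_rec₁ (f := fun _ g => g * 2) 1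
    (nat_mul.comp snd (const 2))).of_eq fun n => ?_
  induction n with
  | zero => rfl
  | succ n ih => rw [pow_succ, ← ih]

theorem primrec_log_two : Primrec (Nat.log 2) := by
  refine (Primrec.nat_findGreatest (f := id) (p := fun M i => i = 0 ∨ 2 ^ i ≤ M) .id ?_).of_eq
    fun M => ?_
  · exact (Primrec.eq.comp snd (const 0)).or (nat_le.comp (primrec_two_pow.comp snd) fst)
  · rw [id, Nat.findGreatest_eq_iff]
    refine ⟨Nat.log_le_self 2 M, fun h => Or.inr (Nat.pow_log_le_self 2 ?_), fun n hn hnM => ?_⟩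
    · rintro rfl; simp at h
    · rw [not_or, not_le]
      exact ⟨by omega, Nat.lt_pow_of_log_lt one_lt_two hn⟩

/-- The depth of the recursion for graphs of size about `M`. -/
def levels (M : ℕ) : ℕ := 8 * (Nat.log 2 M + 1)

/-- The reciprocal of the precision at each level of the recursion. -/
def precision (k M : ℕ) : ℕ := 70 * k * levels M

/-- The number of seeds needed if the size of the graph is rounded to `M`. -/
def seedsFor (k : ℕ) (c : List (ℕ × List ℕ)) (M : ℕ) : ℕ :=
  seedCount (precision k M) c.length.factorial (levels M)

/-- The total number of seeds. The size `n` of the graph is rounded to a random number between `n`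
and `2 * n`. -/
def numSeeds (k : ℕ) (x : List (ℕ × List ℕ) × ℕ × ℕ) : ℕ :=
  max 1 (x.1.length * ∏ i ∈ Finset.range x.1.length, seedsFor k x.1 (x.1.length + i))

/-- The output of the algorithm with a given seed. -/
def run (k : ℕ) (x : List (ℕ × List ℕ) × ℕ × ℕ) (r : ℕ) : List ℕ :=
  let M := x.1.length + r % x.1.length
  x.2.1 :: (segments x.1 (precision k M) (levels M)
    (x.2.1, x.2.2, r / x.1.length % seedsFor k x.1 M) (levels M)).flatMap
      fun p => geodesicTail x.1 p.1 p.2.1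

theorem primrec_levels : Primrec levels :=
  nat_mul.comp (const 8) (succ.comp primrec_log_two)

theorem primrec_precision (k : ℕ) : Primrec (precision k) :=
  nat_mul.comp (const (70 * k)) primrec_levels

theorem primrec_seedsFor (k : ℕ) {c : α → List (ℕ × List ℕ)} {M : α → ℕ} (hc : Primrec c)
    (hM : Primrec M) : Primrec fun a => seedsFor k (c a) (M a) :=
  primrec_seedCount ((primrec_precision k).comp hM) (primrec_factorial.comp (list_length.comp hc))
    (primrec_levels.comp hM)

theorem primrec_numSeeds (k : ℕ) : Primrec (numSeeds k) := by
  have hn : Primrec fun x : List (ℕ × List ℕ) × ℕ × ℕ => x.1.length := list_length.comp fst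
  refine nat_max.comp (const 1) (nat_mul.comp hn ?_)
  refine (Primrec.nat_rec' (f := fun x : List (ℕ × List ℕ) × ℕ × ℕ => x.1.length) (g := fun _ => 1)
    (h := fun x (q : ℕ × ℕ) => q.2 * seedsFor k x.1 (x.1.length + q.1)) hn (const 1)
    (nat_mul.comp (snd.comp snd) (primrec_seedsFor k (fst.comp fst)
      (nat_add.comp (hn.comp fst) (fst.comp snd))))).of_eq fun x => ?_
  have : ∀ m, (Nat.rec 1 (fun i a => a * seedsFor k x.1 (x.1.length + i)) m : ℕ) =
      ∏ i ∈ Finset.range m, seedsFor k x.1 (x.1.length + i) := by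
    intro m
    induction m with
    | zero => rfl
    | succ m ih => rw [Finset.prod_range_succ, ← ih]
  exact this _

theorem primrec_run (k : ℕ) : Primrec₂ (run k) := by
  have hc : Primrec fun z : (List (ℕ × List ℕ) × ℕ × ℕ) × ℕ => z.1.1 := fst.comp fst
  have hs : Primrec fun z : (List (ℕ × List ℕ) × ℕ × ℕ) × ℕ => z.1.2.1 :=
    fst.comp (snd.comp fst)
  have ht : Primrec fun z : (List (ℕ × List ℕ) × ℕ × ℕ) × ℕ => z.1.2.2 :=
    snd.comp (snd.comp fst)
  have hr : Primrec fun z : (List (ℕ × List ℕ) × ℕ × ℕ) × ℕ => z.2 := snd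
  have hn := list_length.comp hc
  have hM := nat_add.comp hn (nat_mod.comp hr hn)
  have hJ := primrec_levels.comp hM
  refine list_cons.comp hs (list_flatMap (primrec_segments hc ((primrec_precision k).comp hM) hJ
    (hs.pair (ht.pair (nat_mod.comp (nat_div.comp hr hn) (primrec_seedsFor k hc hM)))) hJ) ?_)
  exact primrec_geodesicTail (hc.comp fst) (fst.comp snd) (fst.comp (snd.comp snd))

end AdjList

/-- The random walk algorithm with approximation ratio `1 + 1 / k`. -/
def walkAlgorithm (k : ℕ) : PathAlgorithm where
  numSeeds := AdjList.numSeeds k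
  run := AdjList.run k
  numSeeds_pos _ := lt_of_lt_of_le Nat.one_pos (le_max_left _ _)
  computable_numSeeds := (AdjList.primrec_numSeeds k).to_comp
  computable_run := (AdjList.primrec_run k).to_comp

/-! ### Output distribution, approximation ratio and sensitivity of the algorithm -/

namespace AdjList

theorem precision_pos {k : ℕ} (hk : 0 < k) (M : ℕ) : 0 < precision k M := by
  unfold precision levels
  positivity

theorem run_eq (k : ℕ) (c : List (ℕ × List ℕ)) (s t r : ℕ) :
    run k (c, s, t) r = s :: expand c (precision k (c.length + r % c.length))
      (levels (c.length + r % c.length))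
      (s, t, r / c.length % seedsFor k c (c.length + r % c.length)) := by
  rw [← flatMap_segments _ _ _ _ le_rfl, Nat.sub_self]
  rfl

end AdjList

namespace FinGraph

variable {G : FinGraph}

/-- The low digit of the seed selects `M`. The remaining part is uniform below a product over all
possible `M`, so reducing it modulo the seed count of the selected `M` keeps it exactly uniform. -/
theorem outputOn_walkAlgorithm {k : ℕ} (hk : 0 < k) {s t : ℕ} (hs : s ∈ G.verts)
    (h : G.graph.Reachable s t) :
    PathAlgorithm.outputOn (walkAlgorithm k) G s t =
      (uniformOn (Finset.Ico G.verts.card (2 * G.verts.card))).bind fun M =>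
        G.walkPMF (AdjList.precision k M) (AdjList.levels M) s t := by
  have hn : 0 < G.verts.card := Finset.card_pos.2 ⟨s, hs⟩
  set n := G.verts.card with hndef
  have hlen : G.code.length = n := length_code
  have hpos : ∀ M, 0 < AdjList.seedsFor k G.code M := fun M =>
    seedCount_pos (AdjList.precision_pos hk M) (Nat.factorial_pos _) _
  set P := ∏ i ∈ Finset.range n, AdjList.seedsFor k G.code (n + i) with hP
  have hPpos : 0 < P := Finset.prod_pos fun i _ => hpos _
  have hN : AdjList.numSeeds k (G.code, s, t) = n * P := by
    rw [AdjList.numSeeds, hlen]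
    exact max_eq_right (Nat.mul_pos hn hPpos)
  have hout : PathAlgorithm.outputOn (walkAlgorithm k) G s t =
      (uniformOn (Finset.range (n * P))).map (AdjList.run k (G.code, s, t)) := by
    rw [← hN, uniformOn_of_nonempty]
    rfl
  rw [hout, ← PMF.bind_pure_comp]
  have hrun : PMF.pure ∘ AdjList.run k (G.code, s, t) = fun r => PMF.pure
      (s :: AdjList.expand G.code (AdjList.precision k (n + r % n)) (AdjList.levels (n + r % n))
        (s, t, r / n % AdjList.seedsFor k G.code (n + r % n))) := by
    funext r
    rw [Function.comp_apply, AdjList.run_eq, hlen]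
  rw [hrun]
  refine (uniformOn_range_mul_bind hn hPpos (fun i r => PMF.pure
      (s :: AdjList.expand G.code (AdjList.precision k (n + i)) (AdjList.levels (n + i))
        (s, t, r % AdjList.seedsFor k G.code (n + i))))).trans ?_
  have himg : (Finset.range n).image (fun i => n + i) = Finset.Ico n (2 * n) := by
    ext M
    simp only [Finset.mem_image, Finset.mem_range, Finset.mem_Ico]
    constructor
    · rintro ⟨i, hi, rfl⟩
      omega
    · rintro ⟨h1, h2⟩
      exact ⟨M - n, by omega, by omega⟩
  rw [← himg, ← uniformOn_map (Finset.nonempty_range_iff.2 hn.ne')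
    (fun i _ j _ hij => Nat.add_left_cancel hij), PMF.bind_map]
  refine PMF.bind_congr_support _ fun i hi => ?_
  rw [mem_support_uniformOn (Finset.nonempty_range_iff.2 hn.ne')] at hi
  rw [uniformOn_range_bind_mod hPpos (Finset.dvd_prod_of_mem _ hi) (fun r => PMF.pure
      (s :: AdjList.expand G.code (AdjList.precision k (n + i)) (AdjList.levels (n + i)) (s, t, r))),
    Function.comp_apply, ← map_expand_code (AdjList.precision_pos hk _) _ hs h,
    ← PMF.bind_pure_comp]
  rfl

/-- The power is at most `exp (c J / K)`, and `K = 70 k J` cancels the number of levels. It is used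
with `c = 2` for the stretch and `c = 70` for the growth of the cost. -/
theorem one_add_div_precision_pow_le {k : ℕ} (hk : 0 < k) (M : ℕ) {c : ℝ} (hc : 0 ≤ c) :
    (1 + c / (AdjList.precision k M : ℝ)) ^ AdjList.levels M ≤ Real.exp (c / (70 * k)) := by
  have hK : (0 : ℝ) < AdjList.precision k M := by exact_mod_cast AdjList.precision_pos hk M
  have h1 : 1 + c / (AdjList.precision k M : ℝ) ≤ Real.exp (c / AdjList.precision k M) := by
    have := Real.add_one_le_exp (c / (AdjList.precision k M : ℝ))
    linarith
  have hJ : (0 : ℝ) < AdjList.levels M := by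
    unfold AdjList.levels
    positivity
  have hk' : (0 : ℝ) < k := by exact_mod_cast hk
  calc (1 + c / (AdjList.precision k M : ℝ)) ^ AdjList.levels M
      ≤ Real.exp (c / AdjList.precision k M) ^ AdjList.levels M := by gcongr
    _ = Real.exp (c / (70 * k)) := by
      rw [← Real.exp_nat_mul]
      congr 1
      rw [AdjList.precision]
      push_cast
      field_simp

theorem one_add_two_div_precision_pow_le {k : ℕ} (hk : 0 < k) (M : ℕ) :
    (1 + 2 / (AdjList.precision k M : ℝ)) ^ AdjList.levels M ≤ 1 + 1 / (k : ℝ) := by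
  refine (one_add_div_precision_pow_le hk M (by norm_num)).trans ?_
  have hk' : (1 : ℝ) ≤ k := by exact_mod_cast hk
  have hx : (2 : ℝ) / (70 * k) < 1 := by
    rw [div_lt_one (by positivity)]; linarith
  refine (Real.exp_bound_div_one_sub_of_interval (by positivity) hx).trans ?_
  rw [div_le_iff₀ (by linarith)]
  have : (2 : ℝ) / (70 * k) = (1 / 35) * (1 / k) := by field_simp; norm_num
  rw [this]
  have h1 : 1 / (k : ℝ) ≤ 1 := by rw [div_le_one (by linarith)]; exact hk'
  have h0 : 0 < 1 / (k : ℝ) := by positivity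
  nlinarith

theorem one_add_seventy_div_precision_pow_le {k : ℕ} (hk : 0 < k) (M : ℕ) :
    (1 + 70 / (AdjList.precision k M : ℝ)) ^ AdjList.levels M ≤ 3 := by
  refine (one_add_div_precision_pow_le hk M (by norm_num)).trans ?_
  have hk' : (1 : ℝ) ≤ k := by exact_mod_cast hk
  have : (70 : ℝ) / (70 * k) ≤ 1 := by
    rw [div_le_one (by positivity)]; linarith
  calc Real.exp (70 / (70 * k)) ≤ Real.exp 1 := Real.exp_le_exp.2 this
    _ ≤ 3 := by linarith [Real.exp_one_lt_d9]

theorem walkAlgorithm_isWalkOfLength {k : ℕ} (hk : 0 < k) {s t : ℕ} (hs : s ∈ G.verts)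
    (h : G.graph.Reachable s t) (M : ℕ) (l : List ℕ)
    (hl : l ∈ (G.walkPMF (AdjList.precision k M) (AdjList.levels M) s t).support) :
    IsWalkOfLength G.graph s t ((1 + 1 / (k : ℝ)) * G.graph.dist s t) l := by
  refine (isWalkOfLength_walkPMF (AdjList.precision_pos hk M) _ hs h l hl).mono ?_
  gcongr
  exact one_add_two_div_precision_pow_le hk M

theorem walkAlgorithm_isApproximation {k : ℕ} (hk : 0 < k) {ε : ℝ} (hε : 1 / (k : ℝ) ≤ ε) :
    PathAlgorithm.IsApproximation (walkAlgorithm k) (1 + ε) := by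
  intro G s t hs ht h l hl
  rw [outputOn_walkAlgorithm hk hs h, PMF.mem_support_bind_iff] at hl
  obtain ⟨M, -, hl⟩ := hl
  refine (walkAlgorithm_isWalkOfLength hk hs h M l hl).mono ?_
  gcongr

/-- Distances are below `n ≤ M`, so every input segment is short enough for the top level of the
recursion. -/
theorem card_lt_precision_mul_gap {k : ℕ} (hk : 0 < k) (M : ℕ) :
    M < AdjList.precision k M * gap (AdjList.levels M) := by
  have h1 : M < 2 ^ (Nat.log 2 M + 1) := Nat.lt_pow_succ_log_self one_lt_two M
  exact (h1.trans_le (two_pow_le_gap _)).trans_le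
    (Nat.le_mul_of_pos_left _ (AdjList.precision_pos hk M))

/-- The constant is `16 + 12`: `log₂ (2n) + 1 ≤ 2 + 1.5 log n`, times 8, with `log n ≥ 1`. -/
theorem levels_le_log {n M : ℕ} (hn : 3 ≤ n) (hM : M < 2 * n) :
    (AdjList.levels M : ℝ) ≤ 28 * Real.log n := by
  have hn' : (3 : ℝ) ≤ n := by exact_mod_cast hn
  have hlog1 : 1 ≤ Real.log n := by
    rw [Real.le_log_iff_exp_le (by linarith)]
    linarith [Real.exp_one_lt_d9]
  have h1 : (Nat.log 2 M : ℝ) ≤ Real.log (2 * n) / Real.log 2 := by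
    rw [le_div_iff₀ (Real.log_pos one_lt_two), ← Real.log_pow]
    refine Real.log_le_log (by positivity) ?_
    rcases Nat.eq_zero_or_pos M with rfl | hM0
    · simp; linarith
    · have := Nat.pow_log_le_self 2 hM0.ne'
      exact_mod_cast this.trans hM.le
  have h2 : Real.log (2 * n) / Real.log 2 = 1 + Real.log n / Real.log 2 := by
    rw [Real.log_mul (by norm_num) (by linarith), add_div, div_self (Real.log_pos one_lt_two).ne']
  have h3 : Real.log n / Real.log 2 ≤ 1.5 * Real.log n := by
    rw [div_le_iff₀ (Real.log_pos one_lt_two)]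
    have := Real.log_two_gt_d9
    nlinarith
  rw [AdjList.levels]
  push_cast
  linarith

theorem earthMover_le {p q : PMF (List ℕ)} {c : ℝ≥0∞} (h : TransportLE walkCost p q c) :
    earthMover p q ≤ c := by
  obtain ⟨D, h1, h2, h3⟩ := h
  exact (iInf₂_le D ⟨h1, h2⟩).trans h3

theorem transport_output {k : ℕ} (hk : 0 < k) {u v w s t : ℕ} (hw : w ∉ G.verts)
    (huv : G.graph.Adj u v) (hs : s ∈ G.verts) (hsu : s ≠ u ∧ s ≠ v) (htu : t ≠ u ∧ t ≠ v)
    (h : G.graph.Reachable s t) :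
    TransportLE walkCost (PathAlgorithm.outputOn (walkAlgorithm k) G s t)
      (PathAlgorithm.outputOn (walkAlgorithm k) (G.contract u v w) s t)
      (ENNReal.ofReal (50000000 * k * Real.log G.verts.card ^ 3)) := by
  have ht := mem_verts_of_reachable hs h
  have hsV : s ∈ (G.contract u v w).verts := mem_contract_verts.2 (Or.inr ⟨hs, hsu⟩)
  have h' := (contract_reachable_iff hw huv hs hsu ht htu).2 h
  have hu : u ∈ G.verts := G.mem_verts_of_adj huv
  have hv : v ∈ G.verts := G.mem_verts_of_adj huv.symm
  rw [outputOn_walkAlgorithm hk hs h, outputOn_walkAlgorithm hk hsV h']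
  set n := G.verts.card with hn
  have hsub : ({u, v} : Finset ℕ) ⊆ G.verts := by
    intro z hz
    rw [Finset.mem_insert, Finset.mem_singleton] at hz
    rcases hz with rfl | rfl <;> assumption
  have hpair : ({u, v} : Finset ℕ).card = 2 := Finset.card_pair huv.ne
  -- The vertices `s`, `u`, `v` are distinct. This gives `log n ≥ 1`, which absorbs all lower-order
  -- terms.
  have hn3 : 3 ≤ n := by
    have : ({s, u, v} : Finset ℕ).card = 3 := by
      rw [Finset.card_insert_of_notMem (by simp [hsu]), hpair]
    rw [← this]
    refine Finset.card_le_card (Finset.insert_subset hs hsub)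
  have hcard : (G.contract u v w).verts.card = n - 1 := by
    rw [contract, Finset.card_insert_of_notMem (fun h => hw (Finset.mem_sdiff.1 h).1),
      Finset.card_sdiff_of_subset hsub, hpair]
    omega
  rw [hcard]
  have hd : G.graph.dist s t < n := dist_lt_card hs h
  have hd' := contract_dist_le hw hsu htu h
  have hnr : (3 : ℝ) ≤ n := by exact_mod_cast hn3
  have hkr : (1 : ℝ) ≤ k := by exact_mod_cast hk
  have hk2 : (1 : ℝ) + 1 / k ≤ 2 := by
    have : (1 : ℝ) / k ≤ 1 := by rw [div_le_one (by linarith)]; exact hkr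
    linarith
  set x := Real.log n with hx
  have hlog1 : 1 ≤ x := by
    rw [hx, Real.le_log_iff_exp_le (by linarith)]
    linarith [Real.exp_one_lt_d9]
  have hlogs : Real.log (n + 1) ≤ 2 * x := by
    rw [hx, ← Nat.cast_two, ← Real.log_pow]
    exact Real.log_le_log (by positivity) (by nlinarith)
  have hinter : Finset.Ico n (2 * n) ∩ Finset.Ico (n - 1) (2 * (n - 1)) =
      Finset.Ico n (2 * (n - 1)) := by
    ext M
    simp only [Finset.mem_inter, Finset.mem_Ico]
    omega
  -- The two ranges of `M` share `n - 2` values, and the larger has `n`, so `η = 2 / n`. A mismatch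
  -- costs at most two walks of length `2n`, contributing 8 in expectation.
  refine (TransportLE.uniformOn_bind (c := 43500000 * k * x ^ 3) (B := 4 * n) (η := 2 / n)
    (Finset.nonempty_Ico.2 (by omega)) (Finset.nonempty_Ico.2 (by omega)) (by positivity)
    (by positivity) ?_ ?_ ?_).mono (ENNReal.ofReal_le_ofReal ?_)
  · rw [hinter, Nat.card_Ico, Nat.card_Ico, Nat.card_Ico]
    have e1 : max (2 * n - n) (2 * (n - 1) - (n - 1)) = n := by omega
    have e2 : 2 * (n - 1) - n = n - 2 := by omega
    rw [e1, e2, Nat.cast_sub (by omega), sub_div, div_self (by linarith)]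
    push_cast
    linarith
  · intro M hM
    rw [hinter, Finset.mem_Ico] at hM
    have hK : 70 * AdjList.levels M ≤ AdjList.precision k M := by
      rw [AdjList.precision, mul_assoc]
      exact Nat.mul_le_mul_left _ (Nat.le_mul_of_pos_left _ hk)
    have hJ8 : 8 ≤ AdjList.levels M := by unfold AdjList.levels; omega
    refine (transport_walkPMF (J := AdjList.levels M) hw huv (by omega)
      ((one_add_two_div_precision_pow_le hk M).trans hk2) le_rfl _ le_rfl hs hsu htu h ?_).mono
      (ENNReal.ofReal_le_ofReal ?_)
    · exact ((hd.le.trans hM.1).trans (card_lt_precision_mul_gap hk M).le)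
    · have hJ := levels_le_log hn3 (M := M) (by omega)
      have hq := one_add_seventy_div_precision_pow_le hk M
      set J := (AdjList.levels M : ℝ) with hJdef
      have hJ0 : 0 ≤ J := Nat.cast_nonneg _
      have hKJ : (AdjList.precision k M : ℝ) = 70 * k * J := by
        rw [AdjList.precision]; push_cast; rfl
      have hKx : (AdjList.precision k M : ℝ) ≤ 1960 * k * x := by
        rw [hKJ]
        calc 70 * (k : ℝ) * J ≤ 70 * k * (28 * x) := by gcongr
          _ = _ := by ring
      have hlog0 : 0 ≤ Real.log ((n : ℝ) + 1) := Real.log_nonneg (by linarith)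
      -- The main term is `36 · 1960 · 7 = 493920`.
      have hβ : 36 + 36 * (AdjList.precision k M : ℝ) * (2 * Real.log (n + 1) + 3) ≤
          500000 * k * x ^ 2 := by
        have e1 : 2 * Real.log ((n : ℝ) + 1) + 3 ≤ 7 * x := by linarith
        have e2 : 36 * (AdjList.precision k M : ℝ) * (2 * Real.log (n + 1) + 3) ≤
            36 * (1960 * k * x) * (7 * x) := by gcongr
        have e3 : 1 ≤ (k : ℝ) * x ^ 2 := one_le_mul_of_one_le_of_one_le hkr (one_le_pow₀ hlog1)
        nlinarith
      have hJ1 : J + 1 ≤ 29 * x := by linarith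
      calc (36 + 36 * (AdjList.precision k M : ℝ) * (2 * Real.log (n + 1) + 3)) * (J + 1) *
            (1 + 70 / (AdjList.precision k M : ℝ)) ^ AdjList.levels M
          ≤ (500000 * k * x ^ 2) * (29 * x) * 3 := by gcongr
        _ = 43500000 * k * x ^ 3 := by ring
  · intro M _ M' _
    refine TransportLE.of_forall_le fun l hl l' hl' => ?_
    refine (walkDist_le_add (walkAlgorithm_isWalkOfLength hk hs h M l hl)
      (walkAlgorithm_isWalkOfLength hk hsV h' M' l' hl')).trans (ENNReal.ofReal_le_ofReal ?_)
    have e1 : (G.graph.dist s t : ℝ) ≤ n := by exact_mod_cast hd.le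
    have e2 : ((G.contract u v w).graph.dist s t : ℝ) ≤ n := by exact_mod_cast hd'.trans hd.le
    have e3 : (1 + 1 / (k : ℝ)) * G.graph.dist s t ≤ 2 * n := by gcongr
    have e4 : (1 + 1 / (k : ℝ)) * (G.contract u v w).graph.dist s t ≤ 2 * n := by gcongr
    linarith
  · have e1 : (2 : ℝ) / n * (4 * n) = 8 := by field_simp; norm_num
    have e2 : 1 ≤ (k : ℝ) * x ^ 3 := one_le_mul_of_one_le_of_one_le hkr (one_le_pow₀ hlog1)
    rw [e1]
    linarith

end FinGraph

theorem mainTheorem2 :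
    ∃ C : ℝ, 0 < C ∧ ∀ ε : ℝ, 0 < ε →
      ∃ A : PathAlgorithm, PathAlgorithm.IsApproximation A (1 + ε) ∧
        ∀ (G : FinGraph) (s t : ℕ), s ∈ G.verts → t ∈ G.verts → G.graph.Reachable s t →
          PathAlgorithm.contractionSensitivity A G s t ≤
            ENNReal.ofReal (C * max 1 ε⁻¹ * Real.log (G.verts.card : ℝ) ^ 3) := by
  refine ⟨100000000, by norm_num, fun ε hε => ?_⟩
  set k := ⌈ε⁻¹⌉₊ with hkdef
  have hk : 0 < k := Nat.ceil_pos.2 (inv_pos.2 hε)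
  have hk1 : ε⁻¹ ≤ k := Nat.le_ceil _
  -- Rounding `ε⁻¹` up at most doubles `max 1 ε⁻¹`; hence the final constant is twice that of
  -- `transport_output`.
  have hk2 : (k : ℝ) ≤ 2 * max 1 ε⁻¹ := by
    have h1 := Nat.ceil_lt_add_one (inv_pos.2 hε).le
    have h2 := le_max_left 1 ε⁻¹
    have h3 := le_max_right 1 ε⁻¹
    linarith
  refine ⟨walkAlgorithm k, FinGraph.walkAlgorithm_isApproximation hk ?_, ?_⟩
  · rw [one_div]
    exact inv_le_of_inv_le₀ hε hk1
  · intro G s t hs ht h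
    refine iSup_le fun u => iSup_le fun v => iSup_le fun w => iSup_le fun huv =>
      iSup_le fun hdisj => iSup_le fun hw => ?_
    have hne : ∀ z ∈ ({s, t} : Set ℕ), z ≠ u ∧ z ≠ v := by
      intro z hz
      constructor
      · rintro rfl
        exact Set.disjoint_left.1 hdisj (Set.mem_insert _ _) hz
      · rintro rfl
        exact Set.disjoint_left.1 hdisj (Set.mem_insert_of_mem _ rfl) hz
    refine (FinGraph.earthMover_le (FinGraph.transport_output hk hw huv hs
      (hne s (Set.mem_insert _ _)) (hne t (Set.mem_insert_of_mem _ rfl)) h)).trans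
      (ENNReal.ofReal_le_ofReal ?_)
    have hlog : 0 ≤ Real.log (G.verts.card : ℝ) ^ 3 := by
      have := Real.log_natCast_nonneg G.verts.card
      positivity
    exact mul_le_mul_of_nonneg_right (by linarith) hlog
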